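/- Let $M$ be the matroid of the Pappus configuration, i.e. the simple rank-three matroid on $[9]=\{1,\dots,9\}$ whose circuits of size three are exactly the nine lines $$\{1,2,3\},\{1,6,8\},\{1,5,7\},\{2,4,7\},\{2,6,9\},\{7,8,9\},\{4,5,6\},\{3,4,8\},\{3,5,9\}.$$ For a matroid $N$ on $[9]$ of rank at most three, let $\Gamma_N\subset(\mathbb C^3)^9$ be the set of tuples $\gamma=(\gamma_1,\dots,\gamma_9)$ such that for every $S\subseteq[9]$, the set $S$ is dependent in $N$ if and only if the family $(\gamma_i)_{i\in S}$ is linearly dependent. Let the matroid variety $V_N$ be the Zariski closure of $\Gamma_N$ in $\mathbb C^{27}$, and let the circuit variety $V_{\mathcal C(N)}$ be the set of all $\gamma\in(\mathbb C^3)^9$ such that $(\gamma_i)_{i\in S}$ is linearly dependent for every dependent set $S$ of $N$. For $i_1,\dots,i_k\in[9]$ let $N(i_1,\dots,i_k)$ be the matroid on $[9]$ obtained from $N$ by turning $i_1,\dots,i_k$ into loops, so that its independent sets are the independent sets of $N$ containing none of $i_1,\dots,i_k$. Let $U_{2,9}$ be the uniform matroid of rank two on $[9]$. Then $$V_{\mathcal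 C(M(9))}=V_{M(9)}\cup V_{U_{2,9}(9)}\cup V_{M(9,1)}\cup V_{M(9,4)}\cup V_{M(1,4,9)}.$$ -/

import Mathlib

namespace MatroidVar

/-- The simple matroid of rank at most three on `{1, …, d}` determined by a family of lines, any two
of which meet in at most one point: a set is independent when it has at most three elements and is
not a triple of points of a common line. The label `d` is the element `0` of `Fin d`. -/
def ofLines {d : ℕ} (L : Finset (Finset (Fin d)))
    (hL : ∀ l ∈ L, ∀ l' ∈ L, l ≠ l' → (l ∩ l').card ≤ 1) : Matroid (Fin d) :=
  (IndepMatroid.ofFinset Set.univ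
    (fun I : Finset (Fin d) => I.card ≤ 3 ∧ ∀ l ∈ L, I.card = 3 → ¬ I ⊆ l)
    (by simp)
    (by
      rintro I J ⟨hJ, hJl⟩ hIJ
      have hc := Finset.card_le_card hIJ
      refine ⟨hc.trans hJ, fun l hl h3 hIl => hJl l hl (by omega) ?_⟩
      rwa [← Finset.eq_of_subset_of_card_le hIJ (by omega)])
    (by
      rintro I J ⟨hI, hIl⟩ ⟨hJ, hJl⟩ hc
      have hne : (J \ I).Nonempty := by
        rw [Finset.sdiff_nonempty]
        intro h
        have := Finset.card_le_card h
        omega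
      by_contra! hcon
      have key : ∀ e ∈ J, e ∉ I → ∃ l ∈ L, I.card = 2 ∧ insert e I ⊆ l := by
        intro e he heI
        have h := hcon e he heI
        rw [Finset.card_insert_of_notMem heI] at h
        obtain ⟨l, hl, h3, hs⟩ := h (by omega)
        exact ⟨l, hl, by omega, hs⟩
      obtain ⟨e, he⟩ := hne
      rw [Finset.mem_sdiff] at he
      obtain ⟨l, hl, h2, hs⟩ := key e he.1 he.2
      refine hJl l hl (by omega) fun f hf => ?_
      by_cases hfI : f ∈ I
      · exact hs (Finset.mem_insert_of_mem hfI)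
      · obtain ⟨l', hl', -, hs'⟩ := key f hf hfI
        by_cases hll : l = l'
        · exact hll ▸ hs' (Finset.mem_insert_self f I)
        · have h1 := hL l hl l' hl' hll
          have hsub : I ⊆ l ∩ l' := Finset.subset_inter
            ((Finset.subset_insert e I).trans hs) ((Finset.subset_insert f I).trans hs')
          have := Finset.card_le_card hsub
          omega)
    (by simp)).matroid

theorem ofLines_indep_iff {d : ℕ} (L : Finset (Finset (Fin d)))
    (hL : ∀ l ∈ L, ∀ l' ∈ L, l ≠ l' → (l ∩ l').card ≤ 1) (I : Finset (Fin d)) :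
    (ofLines L hL).Indep (I : Set (Fin d)) ↔ I.card ≤ 3 ∧ ∀ l ∈ L, I.card = 3 → ¬ I ⊆ l := by
  rw [ofLines, IndepMatroid.matroid_Indep, IndepMatroid.ofFinset_indep]

/-- The uniform matroid `U_{k,d}` of rank `k` on `{1, …, d}`. -/
def uniform (k d : ℕ) : Matroid (Fin d) :=
  (IndepMatroid.ofFinset Set.univ (fun I : Finset (Fin d) => I.card ≤ k)
    (show (∅ : Finset (Fin d)).card ≤ k from Nat.zero_le k)
    (fun _ _ hJ hIJ => (Finset.card_le_card hIJ).trans hJ)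
    (by
      intro I J _ hJ hc
      obtain ⟨e, he, heI⟩ := Finset.exists_mem_notMem_of_card_lt_card hc
      exact ⟨e, he, heI, by rw [Finset.card_insert_of_notMem heI]; omega⟩)
    (by simp)).matroid

theorem uniform_indep_iff (k d : ℕ) (I : Finset (Fin d)) :
    (uniform k d).Indep (I : Set (Fin d)) ↔ I.card ≤ k := by
  rw [uniform, IndepMatroid.matroid_Indep, IndepMatroid.ofFinset_indep]

/-- `M(J)`: the matroid on the ground set of `M` obtained by turning the points of `J` into loops.
Restricting the deletion of `J` back to the whole ground set re-adjoins `J` as loops. -/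
def makeLoops {α : Type*} (M : Matroid α) (J : Set α) : Matroid α :=
  (M.restrict (M.E \ J)).restrict M.E

theorem makeLoops_indep_iff {α : Type*} (M : Matroid α) (J I : Set α) :
    (makeLoops M J).Indep I ↔ M.Indep I ∧ Disjoint I J := by
  simp only [makeLoops, Matroid.restrict_indep_iff, Set.subset_sdiff]
  constructor
  · rintro ⟨⟨h, -, hd⟩, -⟩
    exact ⟨h, hd⟩
  · rintro ⟨h, hd⟩
    exact ⟨⟨h, h.subset_ground, hd⟩, h.subset_ground⟩

/-- The nine lines of the Pappus configuration, each with three points. In `Fin 9` the label `9` is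
the element `0`, so `1, …, 9` are the nine distinct elements of `Fin 9`. -/
def pappusLines : Finset (Finset (Fin 9)) :=
  {{1, 2, 3}, {1, 6, 8}, {1, 5, 7}, {2, 4, 7}, {2, 6, 9}, {7, 8, 9}, {4, 5, 6}, {3, 4, 8},
    {3, 5, 9}}

set_option maxRecDepth 10000 in
theorem card_inter_pappusLines_le :
    ∀ l ∈ pappusLines, ∀ l' ∈ pappusLines, l ≠ l' → (l ∩ l').card ≤ 1 := by
  decide

/-- The matroid of the Pappus configuration. -/
def pappus : Matroid (Fin 9) :=
  ofLines pappusLines card_inter_pappusLines_le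

/-- `γ` is a realization of `M`: the dependent sets of `M` are exactly the sets of indices for which
the corresponding family of vectors is linearly dependent. -/
def IsRealization {d : ℕ} (M : Matroid (Fin d)) (γ : Fin d → Fin 3 → ℂ) : Prop :=
  ∀ S : Set (Fin d), S ⊆ M.E → (M.Dep S ↔ ¬ LinearIndepOn ℂ γ S)

/-- `γ` includes the dependencies of `M`. -/
def IncludesDependencies {d : ℕ} (M : Matroid (Fin d)) (γ : Fin d → Fin 3 → ℂ) : Prop :=
  ∀ S : Set (Fin d), M.Dep S → ¬ LinearIndepOn ℂ γ S

/-- The realization space `Γ_M`. -/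
def realizationSpace {d : ℕ} (M : Matroid (Fin d)) : Set (Fin d → Fin 3 → ℂ) :=
  {γ | IsRealization M γ}

/-- The Zariski closure of a subset of `ℂ^{3d}`: the common zeros of all polynomials in the `3d`
coordinates that vanish on the set. -/
def zariskiClosure {d : ℕ} (X : Set (Fin d → Fin 3 → ℂ)) : Set (Fin d → Fin 3 → ℂ) :=
  {γ | Function.uncurry γ ∈
    MvPolynomial.zeroLocus ℂ (MvPolynomial.vanishingIdeal ℂ (Function.uncurry '' X))}

/-- The matroid variety `V_M`. -/
def matroidVariety {d : ℕ} (M : Matroid (Fin d)) : Set (Fin d → Fin 3 → ℂ) :=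
  zariskiClosure (realizationSpace M)

/-- The circuit variety `V_{C(M)}`. -/
def circuitVariety {d : ℕ} (M : Matroid (Fin d)) : Set (Fin d → Fin 3 → ℂ) :=
  {γ | IncludesDependencies M γ}

end MatroidVar

namespace MatroidVar

open Filter Topology


/-! The three Pappus lines avoiding both `1` and `4` all contain `9`. Once `9` is a loop, the
remaining six lines say that the hexagon `2, 3, 8, 6, 5, 7` has sides passing alternately through `p
= γ 1` and `q = γ 4`. The components are separated by the vanishing of `p` and `q`.

If both vanish, no condition is left, which gives `M(1,4,9)`. If exactly one vanishes, three lines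
through the other point remain, each carrying two further points, which gives `M(9,1)` or `M(9,4)`.
If both are nonzero, either all vectors lie in a plane, which gives the `U_{2,9}(9)` component, or
the tuple is a limit of hexagons with no vertex in the span of independent `p, q`. Sending the line
`pq` to infinity makes such hexagons rectilinear, so they form a parametrized family containing a
realization of `M(9)`.

The limit statement is proved for an arbitrary closed set. For independent `p, q` with a vertex off
their span, coordinates reduce it to a density statement about chains of proportional pairs
(`chain_mem`). For parallel `p, q`, explicit curves tilt `q` away from `p`
(`ContainsGeneric.mem_of_parallel`).

Matroid varieties are closed in the Euclidean topology, so limits suffice. By the identity theorem a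
holomorphic family of tuples satisfying the dependencies of `M` lies in `V_M` as soon as one member
is a realization (`mem_matroidVariety_of_family`). -/

/-- The determinant of three vectors of `ℂ³`. -/
def det₃ (x y z : Fin 3 → ℂ) : ℂ :=
  x 0 * (y 1 * z 2 - y 2 * z 1) - x 1 * (y 0 * z 2 - y 2 * z 0) + x 2 * (y 0 * z 1 - y 1 * z 0)

theorem exists_eq_comb {p q r : Fin 3 → ℂ} (h : det₃ p q r ≠ 0) (v : Fin 3 → ℂ) :
    ∃ a b c : ℂ, v = a • p + b • q + c • r := by
  refine ⟨det₃ v q r / det₃ p q r, det₃ p v r / det₃ p q r, det₃ p q v / det₃ p q r, ?_⟩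
  rw [← smul_right_injective _ h |>.eq_iff]
  simp only [smul_add, smul_smul, mul_div_cancel₀ _ h]
  ext i
  fin_cases i <;> simp [det₃] <;> ring

theorem det₃_comb_comb (p q r : Fin 3 → ℂ) (a b c a' b' c' : ℂ) :
    det₃ p (a • p + b • q + c • r) (a' • p + b' • q + c' • r) =
      (b * c' - b' * c) * det₃ p q r := by
  simp [det₃]; ring

theorem det₃_comb_comb' (p q r : Fin 3 → ℂ) (a b c a' b' c' : ℂ) :
    det₃ q (a • p + b • q + c • r) (a' • p + b' • q + c' • r) =
      (c * a' - c' * a) * det₃ p q r := by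
  simp [det₃]; ring

/-! ### Density of nonvanishing chains -/

/-- A closed set of parameters containing all nonzero ones contains all. -/
theorem mem_of_forall_ne_zero {S : Set ℂ} (hS : IsClosed S) (h : ∀ t ≠ 0, t ∈ S) (t : ℂ) :
    t ∈ S := by
  have : ({0}ᶜ : Set ℂ) ⊆ S := fun t ht => h t ht
  have := hS.closure_subset_iff.2 this
  rw [(dense_compl_singleton (0 : ℂ)).closure_eq] at this
  exact this trivial

open Function in
/-- In the variety of chains `(cᵢ, cᵢ₊₁) ∥ (yᵢ, zᵢ)`, `i < n`, the chains with nonzero `c` are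
dense. -/
theorem chain_mem (n : ℕ) : ∀ V : Set ((ℕ → ℂ) × (ℕ → ℂ) × (ℕ → ℂ)), IsClosed V →
    (∀ c y z, (∀ i < n, c i * z i = c (i + 1) * y i) → (∀ i ≤ n, c i ≠ 0) → (c, y, z) ∈ V) →
    ∀ c y z, (∀ i < n, c i * z i = c (i + 1) * y i) → (c, y, z) ∈ V := by
  induction n with
  | zero =>
    intro V hV h c y z _
    have := mem_of_forall_ne_zero (S := {t | (update c 0 t, y, z) ∈ V})
      (hV.preimage (by fun_prop)) (fun t ht => h _ _ _ (by simp) (by simp [ht])) (c 0)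
    simpa using this
  | succ n ih =>
    intro V hV h c y z hc
    by_cases h0 : c n = 0 ∧ c (n + 1) = 0
    -- With both entries zero, the last relation leaves `(y n, z n)` free. Move it to a pair `(s,
    -- t)` of nonzero numbers; approximations of the shorter chain then extend by `c (n + 1) = (t /
    -- s) * c n`.
    · have key : ∀ s ≠ 0, ∀ t ≠ 0, (c, update y n s, update z n t) ∈ V := by
        intro s hs t ht
        have := ih {w | (update w.1 (n + 1) (t / s * w.1 n), update w.2.1 n s,
            update w.2.2 n t) ∈ V}
          (hV.preimage (by fun_prop)) ?_ c y z (fun i hi => hc i (by omega))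
        · have hu : update c (n + 1) 0 = c := by rw [← h0.2, update_eq_self]
          simpa [h0.1, hu] using this
        · intro c y z hc hc0
          refine h _ _ _ (fun i hi => ?_) (fun i hi => ?_)
          · rcases Nat.lt_succ_iff_lt_or_eq.1 hi with hi | rfl
            · simpa [update_of_ne, hi.ne, show i ≠ n + 1 by omega] using hc i hi
            · simp; field_simp
          · rcases Nat.le_succ_iff.1 hi with hi | rfl
            · simpa [show i ≠ n + 1 by omega] using hc0 i hi
            · simpa [hs, ht] using hc0 n le_rfl
      have k2 : ∀ s ≠ 0, (c, update y n s, z) ∈ V := fun s hs => by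
        have := mem_of_forall_ne_zero (S := {t | (c, update y n s, update z n t) ∈ V})
          (hV.preimage (by fun_prop)) (fun t ht => key s hs t ht) (z n)
        simpa using this
      have := mem_of_forall_ne_zero (S := {t | (c, update y n t, z) ∈ V})
          (hV.preimage (by fun_prop)) k2 (y n)
      simpa using this
    -- Otherwise `(y n, z n)` is a multiple `l` of `(c n, c (n + 1))`. Keeping `l` fixed preserves
    -- the relation while `c n` and `c (n + 1)` move.
    · obtain ⟨l, hy, hz⟩ : ∃ l, y n = l * c n ∧ z n = l * c (n + 1) := by
        have := hc n (by omega)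
        by_cases h1 : c n = 0
        · have h2 : c (n + 1) ≠ 0 := fun h2 => h0 ⟨h1, h2⟩
          have h3 : y n = 0 := by simpa [h1, h2] using this
          exact ⟨z n / c (n + 1), by simp [h1, h3], by field_simp⟩
        · exact ⟨y n / c n, by field_simp, by field_simp; linear_combination this⟩
      have key : ∀ t ≠ 0, (update c (n + 1) t, y, update z n (l * t)) ∈ V := by
        intro t ht
        have := ih {w | (update w.1 (n + 1) t, update w.2.1 n (l * w.1 n),
            update w.2.2 n (l * t)) ∈ V}
          (hV.preimage (by fun_prop)) ?_ c y z (fun i hi => hc i (by omega))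
        · simpa [← hy] using this
        · intro c y z hc hc0
          refine h _ _ _ (fun i hi => ?_) (fun i hi => ?_)
          · rcases Nat.lt_succ_iff_lt_or_eq.1 hi with hi | rfl
            · simpa [update_of_ne, hi.ne, show i ≠ n + 1 by omega] using hc i hi
            · simp; ring
          · rcases Nat.le_succ_iff.1 hi with hi | rfl
            · simpa [show i ≠ n + 1 by omega] using hc0 i hi
            · simpa using ht
      have := mem_of_forall_ne_zero (S := {t | (update c (n + 1) t, y, update z n (l * t)) ∈ V})
          (hV.preimage (by fun_prop)) key (c (n + 1))
      simpa [← hz] using this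

/-! ### Hexagons with sides alternately through two points -/

/-- The dependencies of a hexagon `x` whose sides pass alternately through `p` and `q`. -/
def HexDeps (p q : Fin 3 → ℂ) (x : Fin 6 → Fin 3 → ℂ) : Prop :=
  det₃ p (x 0) (x 1) = 0 ∧ det₃ q (x 1) (x 2) = 0 ∧ det₃ p (x 2) (x 3) = 0 ∧
    det₃ q (x 3) (x 4) = 0 ∧ det₃ p (x 4) (x 5) = 0 ∧ det₃ q (x 5) (x 0) = 0

/-- A closed set containing the hexagons none of whose vertices lies on the line `pq`. -/
structure ContainsGeneric (V : Set ((Fin 3 → ℂ) × (Fin 3 → ℂ) × (Fin 6 → Fin 3 → ℂ))) : Prop where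
  isClosed : IsClosed V
  mem : ∀ p q x, HexDeps p q x → (∀ i, det₃ p q (x i) ≠ 0) → (p, q, x) ∈ V

theorem HexDeps.rotate {p q : Fin 3 → ℂ} {x : Fin 6 → Fin 3 → ℂ} (h : HexDeps p q x) :
    HexDeps q p (fun i => x (i + 1)) := by
  obtain ⟨h0, h1, h2, h3, h4, h5⟩ := h
  exact ⟨h1, h2, h3, h4, h5, h0⟩

theorem HexDeps.rotate_back {p q : Fin 3 → ℂ} {x : Fin 6 → Fin 3 → ℂ} (h : HexDeps p q x) :
    HexDeps q p (fun i => x (i - 1)) := by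
  obtain ⟨h0, h1, h2, h3, h4, h5⟩ := h
  exact ⟨h5, h0, h1, h2, h3, h4⟩

theorem det₃_swap (p q r : Fin 3 → ℂ) : det₃ q p r = - det₃ p q r := by
  simp [det₃]; ring

theorem ContainsGeneric.rotate {V : Set ((Fin 3 → ℂ) × (Fin 3 → ℂ) × (Fin 6 → Fin 3 → ℂ))}
    (hV : ContainsGeneric V) : ContainsGeneric {w | (w.2.1, w.1, fun i => w.2.2 (i - 1)) ∈ V} where
  isClosed := hV.isClosed.preimage (by fun_prop)
  mem p q x h hx := hV.mem _ _ _ h.rotate_back fun i => by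
    rw [det₃_swap]
    exact neg_ne_zero.2 (hx _)

/-- In the basis `p, q, r = x 0` write `x i = a i • p + b i • q + c i • r`. The two sides at `x 0`
give `b 1 = 0` and `a 5 = 0`. Each other side equates the ratios of consecutive `c` to those of two
coefficients occurring in no other side, so `c 1, …, c 5` form a chain with four links. Since `x i`
lies off `pq` exactly when `c i ≠ 0`, `chain_mem` applies. -/
theorem ContainsGeneric.mem_of_det₃_zero_ne_zero
    {V : Set ((Fin 3 → ℂ) × (Fin 3 → ℂ) × (Fin 6 → Fin 3 → ℂ))}
    (hV : ContainsGeneric V) {p q : Fin 3 → ℂ} {x : Fin 6 → Fin 3 → ℂ} (h : HexDeps p q x)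
    (hx : det₃ p q (x 0) ≠ 0) : (p, q, x) ∈ V := by
  choose a b c habc using fun i => exists_eq_comb hx (x i)
  set r := x 0 with hr
  obtain ⟨h0, h1, h2, h3, h4, h5⟩ := h
  have hb1 : b 1 = 0 := by
    have := det₃_comb_comb p q r 0 0 1 (a 1) (b 1) (c 1)
    rw [← habc 1] at this
    simpa [show det₃ p r (x 1) = 0 from h0, hx] using this
  have ha5 : a 5 = 0 := by
    have := det₃_comb_comb' p q r (a 5) (b 5) (c 5) 0 0 1
    rw [← habc 5] at this
    simpa [show det₃ q (x 5) r = 0 from h5, hx] using this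
  rw [habc 1, habc 2, det₃_comb_comb'] at h1
  rw [habc 2, habc 3, det₃_comb_comb] at h2
  rw [habc 3, habc 4, det₃_comb_comb'] at h3
  rw [habc 4, habc 5, det₃_comb_comb] at h4
  simp only [mul_eq_zero, hx, or_false] at h1 h2 h3 h4
  let F : (ℕ → ℂ) × (ℕ → ℂ) × (ℕ → ℂ) → (Fin 3 → ℂ) × (Fin 3 → ℂ) × (Fin 6 → Fin 3 → ℂ) :=
    fun w => (p, q, ![(0 : ℂ) • p + (0 : ℂ) • q + (1 : ℂ) • r,
      w.2.1 0 • p + (0 : ℂ) • q + w.1 0 • r, w.2.2 0 • p + w.2.1 1 • q + w.1 1 • r,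
      w.2.1 2 • p + w.2.2 1 • q + w.1 2 • r, w.2.2 2 • p + w.2.1 3 • q + w.1 3 • r,
      (0 : ℂ) • p + w.2.2 3 • q + w.1 4 • r])
  have hF : Continuous F := by
    refine .prodMk continuous_const (.prodMk continuous_const (continuous_pi fun i => ?_))
    fin_cases i <;> simp only [Fin.reduceFinMk, Matrix.cons_val] <;> fun_prop
  -- The chain starts at vertex `1`, so its index is one less than the vertex index; values beyond
  -- the last link are irrelevant.
  have := chain_mem 4 (F ⁻¹' V) (hV.isClosed.preimage hF) ?_
    (fun | 0 => c 1 | 1 => c 2 | 2 => c 3 | 3 => c 4 | _ => c 5)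
    (fun | 0 => a 1 | 1 => b 2 | 2 => a 3 | _ => b 4)
    (fun | 0 => a 2 | 1 => b 3 | 2 => a 4 | _ => b 5) ?_
  · convert (show F _ ∈ V from this) using 4
    ext i : 1
    fin_cases i
    · simp [hr]
    · simpa [hb1] using habc 1
    · exact habc 2
    · exact habc 3
    · exact habc 4
    · simpa [ha5] using habc 5
  · intro c y z hc hc0
    refine hV.mem _ _ _ ⟨?_, ?_, ?_, ?_, ?_, ?_⟩ ?_
    · exact (det₃_comb_comb ..).trans (by ring)
    · exact (det₃_comb_comb' ..).trans (by linear_combination det₃ p q r * hc 0 (by simp))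
    · exact (det₃_comb_comb ..).trans (by linear_combination -det₃ p q r * hc 1 (by simp))
    · exact (det₃_comb_comb' ..).trans (by linear_combination det₃ p q r * hc 2 (by simp))
    · exact (det₃_comb_comb ..).trans (by linear_combination -det₃ p q r * hc 3 (by simp))
    · exact (det₃_comb_comb' ..).trans (by ring)
    · have key (a b c : ℂ) (h : c ≠ 0) : det₃ p q (a • p + b • q + c • r) ≠ 0 := by
        have : det₃ p q (a • p + b • q + c • r) = c * det₃ p q r := by simp [det₃]; ring
        rw [this]
        exact mul_ne_zero h hx
      intro i
      fin_cases i
      · exact key _ _ _ one_ne_zero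
      all_goals exact key _ _ _ (hc0 _ (by simp))
  · intro i hi
    interval_cases i
    · linear_combination h1
    · linear_combination -h2
    · linear_combination h3
    · linear_combination -h4

theorem fin_six_rotate_induction {P : Fin 6 → Prop} (h0 : P 0) (h : ∀ i, P i → P (i + 1))
    (i : Fin 6) : P i := by
  have h1 := h 0 h0
  have h2 := h 1 h1
  have h3 := h 2 h2
  have h4 := h 3 h3
  have h5 := h 4 h4
  fin_cases i <;> assumption

/-- Rotating the hexagon by one step exchanges `p` and `q`, which reduces every vertex to vertex
`0`. -/
theorem ContainsGeneric.mem_of_det₃_ne_zero (i : Fin 6) :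
    ∀ {V : Set ((Fin 3 → ℂ) × (Fin 3 → ℂ) × (Fin 6 → Fin 3 → ℂ))},
    ContainsGeneric V → ∀ {p q : Fin 3 → ℂ} {x : Fin 6 → Fin 3 → ℂ}, HexDeps p q x →
    det₃ p q (x i) ≠ 0 → (p, q, x) ∈ V := by
  induction i using fin_six_rotate_induction with
  | h0 => exact fun hV _ _ _ h hx => hV.mem_of_det₃_zero_ne_zero h hx
  | h i ih =>
    intro V hV p q x h hx
    have := ih hV.rotate h.rotate (by rwa [det₃_swap, neg_ne_zero])
    simpa using this

/-- Meant for `q 0` parallel to `p`: tilting `q` makes `p, q t, x t i` a basis for `t ≠ 0`, and the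
limit at `0` stays in the closed set. -/
theorem ContainsGeneric.mem_of_curve
    {V : Set ((Fin 3 → ℂ) × (Fin 3 → ℂ) × (Fin 6 → Fin 3 → ℂ))}
    (hV : ContainsGeneric V) {p : Fin 3 → ℂ} {q : ℂ → Fin 3 → ℂ} {x : ℂ → Fin 6 → Fin 3 → ℂ}
    (hq : Continuous q) (hx : ∀ i, Continuous fun t => x t i) (h : ∀ t, HexDeps p (q t) (x t))
    {i : Fin 6} (hi : ∀ t ≠ 0, det₃ p (q t) (x t i) ≠ 0) : (p, q 0, x 0) ∈ V :=
  mem_of_forall_ne_zero (S := {t | (p, q t, x t) ∈ V}) (hV.isClosed.preimage (by fun_prop))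
    (fun t ht => mem_of_det₃_ne_zero i hV (h t) (hi t ht)) 0

/-! ### Hexagons with the two points parallel -/

theorem det₃_smul_left (k : ℂ) (p x y : Fin 3 → ℂ) : det₃ (k • p) x y = k * det₃ p x y := by
  simp [det₃]; ring

theorem det₃_swap_right (p x y : Fin 3 → ℂ) : det₃ p y x = - det₃ p x y := by
  simp [det₃]; ring

/-- Coordinates of a vector with respect to a basis `p, u, v` in terms of dependencies. -/
theorem exists_eq_comb' {p u v : Fin 3 → ℂ} (h : det₃ p u v ≠ 0) (w : Fin 3 → ℂ) :
    ∃ a b c : ℂ, w = a • p + b • u + c • v ∧ det₃ p w v = b * det₃ p u v ∧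
      det₃ p u w = c * det₃ p u v := by
  obtain ⟨a, b, c, rfl⟩ := exists_eq_comb h w
  refine ⟨a, b, c, rfl, ?_, ?_⟩ <;> · simp [det₃]; ring

/-- In the basis `p, u = x 1, v = x 3`, the vertex `x 2` lies in both planes `pu` and `pv`, so it is
a multiple of `p`; `x 0` lies in `pu` and `x 4` in `pv`. The two sides at `x 5` become `c4 * b5 = 0`
and `b0 * c5 = 0`. In each resulting case `q` is tilted toward `u`, `v` or `x 5`, and vertices
parallel to `p` follow where needed. -/
theorem ContainsGeneric.mem_of_parallel_zero
    {V : Set ((Fin 3 → ℂ) × (Fin 3 → ℂ) × (Fin 6 → Fin 3 → ℂ))}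
    (hV : ContainsGeneric V) {k : ℂ} (hk : k ≠ 0) {p : Fin 3 → ℂ} {x : Fin 6 → Fin 3 → ℂ}
    (h : HexDeps p (k • p) x) (hx : det₃ p (x 1) (x 3) ≠ 0) : (p, k • p, x) ∈ V := by
  obtain ⟨h0, h1, h2, h3, h4, h5⟩ := h
  simp only [det₃_smul_left, mul_eq_zero, hk, false_or] at h1 h3 h5
  have hx0 : x = ![x 0, x 1, x 2, x 3, x 4, x 5] := by
    ext i; fin_cases i <;> rfl
  obtain ⟨a0, b0, c0, e0, -, hc0⟩ := exists_eq_comb' hx (x 0)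
  obtain ⟨a2, b2, c2, e2, hb2, hc2⟩ := exists_eq_comb' hx (x 2)
  obtain ⟨a4, b4, c4, e4, hb4, -⟩ := exists_eq_comb' hx (x 4)
  obtain ⟨a5, b5, c5, e5, -, -⟩ := exists_eq_comb' hx (x 5)
  rw [det₃_swap_right] at hc0 hb4
  rw [h0] at hc0
  rw [h1] at hc2
  rw [h2] at hb2
  rw [h3] at hb4
  simp only [neg_zero, zero_eq_mul, hx, or_false] at hc0 hc2 hb2 hb4
  subst hc0 hc2 hb2 hb4
  rw [e4, e5, det₃_comb_comb] at h4
  rw [e0, e5, det₃_comb_comb] at h5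
  have hx' : det₃ p (x 3) (x 1) ≠ 0 := by rwa [det₃_swap_right, neg_ne_zero]
  generalize x 0 = x0, x 1 = u, x 2 = x2, x 3 = v, x 4 = x4, x 5 = x5 at *
  subst hx0 e0 e2 e4 e5
  replace h4 : c4 = 0 ∨ b5 = 0 := by simpa [hx, or_comm] using h4
  replace h5 : b0 = 0 ∨ c5 = 0 := by simpa [hx] using h5
  -- A vertex `(s * k) • p` equals `s • q` at `t = 0`, so it can be made to travel with `q`.
  obtain ⟨s2, rfl⟩ : ∃ s, a2 = s * k := ⟨a2 / k, by field_simp⟩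
  rcases h4 with rfl | rfl <;> rcases h5 with rfl | rfl
  · by_cases hc5 : c5 = 0
    · subst hc5
      obtain ⟨s4, rfl⟩ : ∃ s, a4 = s * k := ⟨a4 / k, by field_simp⟩
      have := hV.mem_of_curve (p := p) (q := fun t => k • p + t • u)
        (x := fun t => ![a0 • p, u, (s2 * k) • p, v, s4 • (k • p + t • u), a5 • p + b5 • u])
        (by fun_prop) (by intro i; fin_cases i <;> simp <;> fun_prop)
        (fun t => by refine ⟨?_, ?_, ?_, ?_, ?_, ?_⟩ <;> simp [det₃] <;> ring)
        (i := 3) (fun t ht => by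
          convert mul_ne_zero ht hx using 1; simp [det₃]; ring)
      simpa [smul_smul] using this
    · obtain ⟨s4, rfl⟩ : ∃ s, a4 = s * k := ⟨a4 / k, by field_simp⟩
      -- Here `q` tilts toward `x 5`. The moving `x 2` is a multiple of `q` stripped of its `u`
      -- component, so it lies in the span of `q, u` and in that of `p, v`.
      have := hV.mem_of_curve (p := p) (q := fun t => k • p + t • (a5 • p + b5 • u + c5 • v))
        (x := fun t => ![a0 • p, u, s2 • (k • p + t • (a5 • p + c5 • v)), v,
          s4 • (k • p + t • (a5 • p + b5 • u + c5 • v)), a5 • p + b5 • u + c5 • v])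
        (by fun_prop) (by intro i; fin_cases i <;> simp <;> fun_prop)
        (fun t => by refine ⟨?_, ?_, ?_, ?_, ?_, ?_⟩ <;> simp [det₃] <;> ring)
        (i := 1) (fun t ht => by
          convert mul_ne_zero (mul_ne_zero ht hc5) hx' using 1; simp [det₃]; ring)
      simpa [smul_smul] using this
  · obtain ⟨s4, rfl⟩ : ∃ s, a4 = s * k := ⟨a4 / k, by field_simp⟩
    have := hV.mem_of_curve (p := p) (q := fun t => k • p + t • u)
      (x := fun t => ![a0 • p + b0 • u, u, (s2 * k) • p, v, s4 • (k • p + t • u), a5 • p + b5 • u])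
      (by fun_prop) (by intro i; fin_cases i <;> simp <;> fun_prop)
      (fun t => by refine ⟨?_, ?_, ?_, ?_, ?_, ?_⟩ <;> simp [det₃] <;> ring)
      (i := 3) (fun t ht => by
        convert mul_ne_zero ht hx using 1; simp [det₃]; ring)
    simpa [smul_smul] using this
  · have := hV.mem_of_curve (p := p) (q := fun t => k • p + t • v)
      (x := fun t => ![a0 • p, u, s2 • (k • p + t • v), v, a4 • p + c4 • v, a5 • p + c5 • v])
      (by fun_prop) (by intro i; fin_cases i <;> simp <;> fun_prop)
      (fun t => by refine ⟨?_, ?_, ?_, ?_, ?_, ?_⟩ <;> simp [det₃] <;> ring)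
      (i := 1) (fun t ht => by
        convert mul_ne_zero ht hx' using 1; simp [det₃]; ring)
    simpa [smul_smul] using this
  · obtain ⟨s5, rfl⟩ : ∃ s, a5 = s * k := ⟨a5 / k, by field_simp⟩
    have := hV.mem_of_curve (p := p) (q := fun t => k • p + t • v)
      (x := fun t => ![a0 • p + b0 • u, u, s2 • (k • p + t • v), v, a4 • p + c4 • v,
        s5 • (k • p + t • v)])
      (by fun_prop) (by intro i; fin_cases i <;> simp <;> fun_prop)
      (fun t => by refine ⟨?_, ?_, ?_, ?_, ?_, ?_⟩ <;> simp [det₃] <;> ring)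
      (i := 1) (fun t ht => by
        convert mul_ne_zero ht hx' using 1; simp [det₃]; ring)
    simpa [smul_smul] using this

/-- Each vertex other than `u = x 1` and `v = x 4` is at distance one or two from both of them, so
it lies in both planes `pu` and `pv` and is a multiple of `p`. Tilt `q` toward `v`, letting `x 2`
and `x 5` follow it. -/
theorem ContainsGeneric.mem_of_parallel_of_opposite_zero
    {V : Set ((Fin 3 → ℂ) × (Fin 3 → ℂ) × (Fin 6 → Fin 3 → ℂ))}
    (hV : ContainsGeneric V) {k : ℂ} (hk : k ≠ 0) {p : Fin 3 → ℂ} {x : Fin 6 → Fin 3 → ℂ}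
    (h : HexDeps p (k • p) x) (h' : ∀ i, det₃ p (x (i + 1)) (x (i + 3)) = 0)
    (hx : det₃ p (x 1) (x 4) ≠ 0) : (p, k • p, x) ∈ V := by
  obtain ⟨h0, h1, h2, h3, h4, h5⟩ := h
  simp only [det₃_smul_left, mul_eq_zero, hk, false_or] at h1 h3 h5
  have key (w : Fin 3 → ℂ) (h1 : det₃ p w (x 4) = 0) (h2 : det₃ p (x 1) w = 0) :
      ∃ a : ℂ, w = a • p := by
    obtain ⟨a, b, c, e, hb, hc⟩ := exists_eq_comb' hx w
    refine ⟨a, ?_⟩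
    simp only [h1, h2, zero_eq_mul, hx, or_false] at hb hc
    simpa [hb, hc] using e
  obtain ⟨a0, e0⟩ := key (x 0) (by rw [det₃_swap_right, neg_eq_zero]; exact h' 3)
    (by rw [det₃_swap_right, neg_eq_zero]; exact h0)
  obtain ⟨a2, e2⟩ := key (x 2) (h' 1) h1
  obtain ⟨a3, e3⟩ := key (x 3) h3 (h' 0)
  obtain ⟨a5, e5⟩ := key (x 5) (by rw [det₃_swap_right, neg_eq_zero]; exact h4)
    (by rw [det₃_swap_right, neg_eq_zero]; exact h' 4)
  have hx0 : x = ![x 0, x 1, x 2, x 3, x 4, x 5] := by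
    ext i; fin_cases i <;> rfl
  have hx' : det₃ p (x 4) (x 1) ≠ 0 := by rwa [det₃_swap_right, neg_ne_zero]
  clear h' h0 h1 h2 h3 h4 h5 key
  generalize x 0 = x0, x 1 = u, x 2 = x2, x 3 = x3, x 4 = v, x 5 = x5 at *
  subst hx0 e0 e2 e3 e5
  obtain ⟨s2, rfl⟩ : ∃ s, a2 = s * k := ⟨a2 / k, by field_simp⟩
  obtain ⟨s5, rfl⟩ : ∃ s, a5 = s * k := ⟨a5 / k, by field_simp⟩
  have := hV.mem_of_curve (p := p) (q := fun t => k • p + t • v)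
    (x := fun t => ![a0 • p, u, s2 • (k • p + t • v), a3 • p, v, s5 • (k • p + t • v)])
    (by fun_prop) (by intro i; fin_cases i <;> simp <;> fun_prop)
    (fun t => by refine ⟨?_, ?_, ?_, ?_, ?_, ?_⟩ <;> simp [det₃] <;> ring)
    (i := 1) (fun t ht => by
      convert mul_ne_zero ht hx' using 1; simp [det₃]; ring)
  simpa [smul_smul] using this

theorem HexDeps.rotate_parallel {k : ℂ} (hk : k ≠ 0) {p : Fin 3 → ℂ} {x : Fin 6 → Fin 3 → ℂ}
    (h : HexDeps p (k • p) x) : HexDeps (k • p) (k⁻¹ • k • p) (fun i => x (i + 1)) := by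
  rw [inv_smul_smul₀ hk]
  exact h.rotate

theorem ContainsGeneric.mem_of_parallel_of_distance_two (i : Fin 6) :
    ∀ {V : Set ((Fin 3 → ℂ) × (Fin 3 → ℂ) × (Fin 6 → Fin 3 → ℂ))},
    ContainsGeneric V → ∀ {k : ℂ}, k ≠ 0 → ∀ {p : Fin 3 → ℂ} {x : Fin 6 → Fin 3 → ℂ},
    HexDeps p (k • p) x → det₃ p (x (i + 1)) (x (i + 3)) ≠ 0 → (p, k • p, x) ∈ V := by
  induction i using fin_six_rotate_induction with
  | h0 => exact fun hV _ hk _ _ h hx => hV.mem_of_parallel_zero hk h hx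
  | h i ih =>
    intro V hV k hk p x h hx
    have := ih hV.rotate (inv_ne_zero hk) (h.rotate_parallel hk) (by
      rw [det₃_smul_left, add_right_comm i 3]
      exact mul_ne_zero hk hx)
    simpa [inv_smul_smul₀ hk] using this

theorem ContainsGeneric.mem_of_parallel_of_opposite (i : Fin 6) :
    ∀ {V : Set ((Fin 3 → ℂ) × (Fin 3 → ℂ) × (Fin 6 → Fin 3 → ℂ))},
    ContainsGeneric V → ∀ {k : ℂ}, k ≠ 0 → ∀ {p : Fin 3 → ℂ} {x : Fin 6 → Fin 3 → ℂ},
    HexDeps p (k • p) x → (∀ i, det₃ p (x (i + 1)) (x (i + 3)) = 0) →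
    det₃ p (x (i + 1)) (x (i + 4)) ≠ 0 → (p, k • p, x) ∈ V := by
  induction i using fin_six_rotate_induction with
  | h0 => exact fun hV _ hk _ _ h h' hx => hV.mem_of_parallel_of_opposite_zero hk h h' hx
  | h i ih =>
    intro V hV k hk p x h h' hx
    have := ih hV.rotate (inv_ne_zero hk) (h.rotate_parallel hk) (fun j => by
      rw [det₃_smul_left, add_right_comm j 3, h', mul_zero]) (by
      rw [det₃_smul_left, add_right_comm i 4]
      exact mul_ne_zero hk hx)
    simpa [inv_smul_smul₀ hk] using this

/-- Two vertices of a hexagon are at distance at most three. Adjacent ones are dependent with `p`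
because `q` is parallel to `p`; distances two and three are the two preceding lemmas. -/
theorem ContainsGeneric.mem_of_parallel
    {V : Set ((Fin 3 → ℂ) × (Fin 3 → ℂ) × (Fin 6 → Fin 3 → ℂ))}
    (hV : ContainsGeneric V) {k : ℂ} (hk : k ≠ 0) {p : Fin 3 → ℂ} {x : Fin 6 → Fin 3 → ℂ}
    (h : HexDeps p (k • p) x) {i j : Fin 6} (hx : det₃ p (x i) (x j) ≠ 0) : (p, k • p, x) ∈ V := by
  by_contra hcon
  have h2 : ∀ i, det₃ p (x (i + 1)) (x (i + 3)) = 0 := fun i => by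
    by_contra h'
    exact hcon (mem_of_parallel_of_distance_two i hV hk h h')
  have h3 : ∀ i, det₃ p (x (i + 1)) (x (i + 4)) = 0 := fun i => by
    by_contra h'
    exact hcon (mem_of_parallel_of_opposite i hV hk h h2 h')
  have h1 : ∀ i, det₃ p (x i) (x (i + 1)) = 0 := fun i => by
    obtain ⟨h0, h1, h2, h3, h4, h5⟩ := h
    simp only [det₃_smul_left, mul_eq_zero, hk, false_or] at h1 h3 h5
    fin_cases i <;> assumption
  have h0 : ∀ i, det₃ p (x i) (x i) = 0 := fun i => by simp [det₃]; ring
  replace h2 : ∀ i, det₃ p (x i) (x (i + 2)) = 0 := fun i => by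
    have := h2 (i - 1)
    rwa [sub_add_cancel, sub_add_eq_add_sub, add_sub_assoc] at this
  replace h3 : ∀ i, det₃ p (x i) (x (i + 3)) = 0 := fun i => by
    have := h3 (i - 1)
    rwa [sub_add_cancel, sub_add_eq_add_sub, add_sub_assoc] at this
  have key : ∀ i j : Fin 6, j = i ∨ j = i + 1 ∨ j = i + 2 ∨ j = i + 3 ∨ i = j + 1 ∨ i = j + 2 := by
    decide
  rcases key i j with rfl | rfl | rfl | rfl | rfl | rfl
  · exact hx (h0 _)
  · exact hx (h1 _)
  · exact hx (h2 _)
  · exact hx (h3 _)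
  · rw [det₃_swap_right, h1, neg_zero] at hx; exact hx rfl
  · rw [det₃_swap_right, h2, neg_zero] at hx; exact hx rfl


/-! ### Zariski closures and holomorphic curves -/

theorem isClosed_zariskiClosure {d : ℕ} (X : Set (Fin d → Fin 3 → ℂ)) :
    IsClosed (zariskiClosure X) := by
  have : zariskiClosure X = ⋂ P ∈ MvPolynomial.vanishingIdeal ℂ (Function.uncurry '' X),
      {γ | MvPolynomial.aeval (Function.uncurry γ) P = 0} := by
    ext γ; simp [zariskiClosure]
  rw [this]
  refine isClosed_biInter fun P _ => isClosed_eq ?_ continuous_const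
  exact (MvPolynomial.continuous_eval P).comp
    (continuous_pi fun i => by simp only [Function.uncurry]; fun_prop)

theorem closure_subset_zariskiClosure {d : ℕ} (X : Set (Fin d → Fin 3 → ℂ)) :
    closure X ⊆ zariskiClosure X :=
  closure_minimal (fun γ hγ _ hP => hP _ ⟨γ, hγ, rfl⟩) (isClosed_zariskiClosure X)

theorem differentiable_linearMap_apply {ι : Type*} (f : (Fin 3 → ℂ) →ₗ[ℂ] (ι → ℂ))
    {v : ℂ → Fin 3 → ℂ} (hv : Differentiable ℂ v) (j : ι) :
    Differentiable ℂ fun u => f (v u) j := by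
  have : ∀ u, f (v u) j = ∑ i, v u i * f (fun k => if i = k then 1 else 0) j := fun u => by
    rw [LinearMap.pi_apply_eq_sum_univ f, Finset.sum_apply]
    rfl
  simp only [this]
  fun_prop

theorem differentiable_det {ι : Type*} [Fintype ι] [DecidableEq ι] {A : ℂ → ι → ι → ℂ}
    (hA : ∀ i j, Differentiable ℂ fun u => A u i j) :
    Differentiable ℂ fun u => (Matrix.of (A u)).det := by
  simp only [Matrix.det_apply', Matrix.of_apply]
  exact .fun_sum fun σ _ => (differentiable_const _).mul (.fun_finsetProd fun i _ => hA _ _)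

/-- Linear independence along a holomorphic curve holds generically once it holds somewhere. -/
theorem eventually_linearIndepOn {d : ℕ} {γ : ℂ → Fin d → Fin 3 → ℂ} (hγ : Differentiable ℂ γ)
    {S : Set (Fin d)} {s : ℂ} (h : LinearIndepOn ℂ (γ s) S) (t : ℂ) :
    ∀ᶠ u in 𝓝[≠] t, LinearIndepOn ℂ (γ u) S := by
  classical
  -- A left inverse `f` at the parameter `s` turns independence into a nonzero determinant `g`: an
  -- entire function with `g s = 1`, whose zeros are isolated by the identity theorem.
  obtain ⟨f, hf⟩ := LinearMap.exists_leftInverse_of_injective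
    (Fintype.linearCombination ℂ (fun i : S => γ s i))
    (LinearMap.ker_eq_bot.2 (linearIndependent_iff_injective_fintypeLinearCombination.1 h))
  have hf' : ∀ i : S, f (γ s i) = Pi.single i 1 := fun i => by
    have := LinearMap.congr_fun hf (Pi.single i 1)
    simpa [Fintype.linearCombination_apply_single] using this
  let g : ℂ → ℂ := fun u => Matrix.det (Matrix.of fun i j : S => f (γ u i) j)
  have hg : Differentiable ℂ g := by
    have he (i j : S) : Differentiable ℂ fun u => f (γ u i) j :=
      differentiable_linearMap_apply f (differentiable_pi.1 hγ i) j
    exact differentiable_det he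
  have hg1 : g s ≠ 0 := by
    have : (Matrix.of fun i j : S => f (γ s i) j) = 1 := by
      ext i j
      simp [hf', Matrix.one_apply, Pi.single_apply, eq_comm]
    simp [g, this]
  have ha : AnalyticOnNhd ℂ g Set.univ := fun z _ => hg.analyticAt z
  have hne : ∀ᶠ u in 𝓝[≠] t, g u ≠ 0 := by
    rcases (ha t trivial).eventually_eq_zero_or_eventually_ne_zero with h0 | h0
    · exact absurd (ha.eqOn_zero_of_preconnected_of_eventuallyEq_zero isPreconnected_univ trivial h0
        (Set.mem_univ s)) hg1
    · exact h0
  filter_upwards [hne] with u hu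
  exact LinearIndependent.of_comp f (Matrix.linearIndependent_rows_of_det_ne_zero hu)

theorem isRealization_of_indep {d : ℕ} {M : Matroid (Fin d)} {γ : Fin d → Fin 3 → ℂ}
    (h : IncludesDependencies M γ) (hI : ∀ S, M.Indep S → LinearIndepOn ℂ γ S) :
    IsRealization M γ := fun S hS =>
  ⟨h S, fun hdep => (Matroid.not_indep_iff hS).1 fun hi => hdep (hI S hi)⟩

theorem IsRealization.linearIndepOn {d : ℕ} {M : Matroid (Fin d)} {γ : Fin d → Fin 3 → ℂ}
    (h : IsRealization M γ) {S : Set (Fin d)} (hS : M.Indep S) : LinearIndepOn ℂ γ S := by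
  by_contra hn
  exact ((h S hS.subset_ground).2 hn).not_indep hS

/-- A holomorphic curve of tuples including the dependencies of `M`, one of which is a realization,
lies in the matroid variety. -/
theorem mem_matroidVariety_of_curve {d : ℕ} {M : Matroid (Fin d)} {γ : ℂ → Fin d → Fin 3 → ℂ}
    (hγ : Differentiable ℂ γ) (h : ∀ t, IncludesDependencies M (γ t)) {s : ℂ}
    (h1 : IsRealization M (γ s)) (t : ℂ) : γ t ∈ matroidVariety M := by
  refine closure_subset_zariskiClosure _ ?_
  have : ∀ᶠ u in 𝓝[≠] t, ∀ S, M.Indep S → LinearIndepOn ℂ (γ u) S := by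
    rw [eventually_all]
    intro S
    by_cases hS : M.Indep S
    · filter_upwards [eventually_linearIndepOn hγ (h1.linearIndepOn hS) t] with u hu _ using hu
    · simp [hS]
  exact mem_closure_of_tendsto (hγ.continuous.continuousAt.tendsto.mono_left nhdsWithin_le_nhds)
    (this.mono fun u hu => isRealization_of_indep (h u) hu)

/-! ### Criteria for dependencies and realizations -/

theorem linearIndependent_iff_det₃_ne_zero (v : Fin 3 → Fin 3 → ℂ) :
    LinearIndependent ℂ v ↔ det₃ (v 0) (v 1) (v 2) ≠ 0 := by
  have : det₃ (v 0) (v 1) (v 2) = (Matrix.of v).det := by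
    rw [Matrix.det_fin_three]; simp [det₃]; ring
  rw [this, ← isUnit_iff_ne_zero, ← Matrix.isUnit_iff_isUnit_det]
  exact Matrix.linearIndependent_rows_iff_isUnit (A := Matrix.of v)

theorem linearIndepOn_triple {d : ℕ} (γ : Fin d → Fin 3 → ℂ) {i j k : Fin d} (hij : i ≠ j)
    (hik : i ≠ k) (hjk : j ≠ k) :
    LinearIndepOn ℂ γ {i, j, k} ↔ det₃ (γ i) (γ j) (γ k) ≠ 0 := by
  have hinj : Function.Injective ![i, j, k] := by
    intro a b
    fin_cases a <;> fin_cases b <;> simp [hij, hik, hjk, hij.symm, hik.symm, hjk.symm]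
  have hr : Set.range ![i, j, k] = {i, j, k} := by
    ext x; simp [eq_comm]; tauto
  rw [← hr, linearIndepOn_range_iff hinj, linearIndependent_iff_det₃_ne_zero]
  simp

theorem not_linearIndepOn_of_card {d : ℕ} (γ : Fin d → Fin 3 → ℂ) {S : Finset (Fin d)}
    (hS : 3 < S.card) : ¬ LinearIndepOn ℂ γ (S : Set (Fin d)) := fun h => by
  have := LinearIndependent.fintype_card_le_finrank h
  simp at this
  omega

theorem not_linearIndepOn_of_mem {d : ℕ} {γ : Fin d → Fin 3 → ℂ} {S : Set (Fin d)} {i : Fin d}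
    (hi : i ∈ S) (h : γ i = 0) : ¬ LinearIndepOn ℂ γ S := fun hS => hS.ne_zero hi h

theorem makeLoops_pappus_indep_iff (J : Set (Fin 9)) (S : Finset (Fin 9)) :
    (makeLoops pappus J).Indep S ↔
      (S.card ≤ 3 ∧ ∀ l ∈ pappusLines, S.card = 3 → ¬ S ⊆ l) ∧ Disjoint (S : Set (Fin 9)) J := by
  rw [makeLoops_indep_iff, pappus, ofLines_indep_iff]

set_option maxRecDepth 10000 in
theorem card_pappusLines : ∀ l ∈ pappusLines, l.card = 3 := by decide

theorem includesDependencies_makeLoops_pappus {J : Set (Fin 9)} {γ : Fin 9 → Fin 3 → ℂ}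
    (hJ : ∀ i ∈ J, γ i = 0)
    (hl : ∀ l ∈ pappusLines, Disjoint (l : Set (Fin 9)) J → ¬ LinearIndepOn ℂ γ (l : Set (Fin 9))) :
    IncludesDependencies (makeLoops pappus J) γ := by
  intro S hS
  obtain ⟨S, rfl⟩ := S.toFinite.exists_finset_coe
  have hS' := hS.not_indep
  rw [makeLoops_pappus_indep_iff] at hS'
  by_cases hd : Disjoint (S : Set (Fin 9)) J
  · by_cases hc : S.card ≤ 3
    · simp only [hd, and_true, hc, true_and, not_forall, not_not] at hS'
      obtain ⟨l, hl', h3, hsub⟩ := hS'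
      obtain rfl := Finset.eq_of_subset_of_card_le hsub (by rw [h3, card_pappusLines l hl'])
      exact hl S hl' hd
    · exact not_linearIndepOn_of_card γ (by omega)
  · obtain ⟨i, hi, hiJ⟩ := Set.not_disjoint_iff.1 hd
    exact not_linearIndepOn_of_mem hi (hJ i hiJ)

/-- A matroid on a finite set all of whose independent sets have at most `k` elements, and which has
an independent set of `k` elements, is realized once its independent `k`-sets are independent. -/
theorem isRealization_of_card {d k : ℕ} {M : Matroid (Fin d)} {γ : Fin d → Fin 3 → ℂ}
    (h : IncludesDependencies M γ) (hk : ∀ S : Finset (Fin d), M.Indep S → S.card ≤ k)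
    {B₀ : Finset (Fin d)} (hB₀ : M.Indep B₀) (hB₀k : B₀.card = k)
    (hI : ∀ S : Finset (Fin d), M.Indep S → S.card = k → LinearIndepOn ℂ γ (S : Set (Fin d))) :
    IsRealization M γ := by
  -- Extend to a base. All bases have the same size, which `B₀` forces to be `k`, and independence
  -- passes to subsets.
  refine isRealization_of_indep h fun S hS => ?_
  obtain ⟨B, hB, hSB⟩ := hS.exists_isBase_superset
  obtain ⟨B₁, hB₁, hSB₁⟩ := hB₀.exists_isBase_superset
  obtain ⟨B, rfl⟩ := B.toFinite.exists_finset_coe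
  obtain ⟨B₁, rfl⟩ := B₁.toFinite.exists_finset_coe
  have h1 := hB.ncard_eq_ncard_of_isBase hB₁
  rw [Set.ncard_coe_finset, Set.ncard_coe_finset] at h1
  have h2 := Finset.card_le_card (Finset.coe_subset.1 hSB₁)
  have h3 := hk B hB.indep
  exact (hI B hB.indep (by omega)).mono hSB

theorem isRealization_makeLoops_pappus {J : Set (Fin 9)} {γ : Fin 9 → Fin 3 → ℂ}
    (h : IncludesDependencies (makeLoops pappus J) γ) {B₀ : Finset (Fin 9)}
    (hB₀ : (makeLoops pappus J).Indep B₀) (hB₀k : B₀.card = 3)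
    (hI : ∀ i j k, i < j → j < k → i ∉ J → j ∉ J → k ∉ J → {i, j, k} ∉ pappusLines →
      det₃ (γ i) (γ j) (γ k) ≠ 0) :
    IsRealization (makeLoops pappus J) γ := by
  refine isRealization_of_card h (fun S hS => ((makeLoops_pappus_indep_iff J S).1 hS).1.1) hB₀ hB₀k
    fun S hS hc => ?_
  rw [makeLoops_pappus_indep_iff] at hS
  obtain ⟨⟨-, hl⟩, hd⟩ := hS
  -- The increasing enumeration makes it enough to test triples `i < j < k`.
  set e := S.orderEmbOfFin hc
  have he : ∀ i, e i ∉ J := fun i => Set.disjoint_left.1 hd (Finset.orderEmbOfFin_mem S hc i)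
  have hr : Set.range e = S := Finset.range_orderEmbOfFin S hc
  rw [← hr, linearIndepOn_range_iff e.injective, linearIndependent_iff_det₃_ne_zero]
  refine hI _ _ _ (e.strictMono (by decide)) (e.strictMono (by decide)) (he 0) (he 1) (he 2) ?_
  have : S = {e 0, e 1, e 2} := by
    rw [← Finset.coe_inj, ← hr]
    ext x; simp [Fin.exists_fin_succ, eq_comm]
  rw [← this]
  exact fun hS => hl S hS hc subset_rfl

/-- The determinant of three integer vectors. -/
def intDet₃ (x y z : Fin 3 → ℤ) : ℤ :=
  x 0 * (y 1 * z 2 - y 2 * z 1) - x 1 * (y 0 * z 2 - y 2 * z 0) + x 2 * (y 0 * z 1 - y 1 * z 0)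

theorem det₃_intCast (x y z : Fin 3 → ℤ) :
    det₃ (fun i => (x i : ℂ)) (fun i => (y i : ℂ)) (fun i => (z i : ℂ)) = intDet₃ x y z := by
  simp [det₃, intDet₃]

theorem forall_pappusLines {P : Finset (Fin 9) → Prop} : (∀ l ∈ pappusLines, P l) ↔
    P {1, 2, 3} ∧ P {1, 6, 8} ∧ P {1, 5, 7} ∧ P {2, 4, 7} ∧ P {2, 6, 9} ∧ P {7, 8, 9} ∧
      P {4, 5, 6} ∧ P {3, 4, 8} ∧ P {3, 5, 9} := by
  simp [pappusLines]


/-! ### Equations of the circuit variety -/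

theorem zero_of_mem_zariskiClosure {d : ℕ} {X : Set (Fin d → Fin 3 → ℂ)} {i : Fin d}
    (h : ∀ γ ∈ X, γ i = 0) {γ : Fin d → Fin 3 → ℂ} (hγ : γ ∈ zariskiClosure X) : γ i = 0 := by
  ext j
  have := hγ (MvPolynomial.X (i, j)) (by
    rintro _ ⟨δ, hδ, rfl⟩
    simp [h δ hδ])
  simpa using this

theorem det₃_zero_of_mem_zariskiClosure {d : ℕ} {X : Set (Fin d → Fin 3 → ℂ)} {i j k : Fin d}
    (h : ∀ γ ∈ X, det₃ (γ i) (γ j) (γ k) = 0) {γ : Fin d → Fin 3 → ℂ}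
    (hγ : γ ∈ zariskiClosure X) : det₃ (γ i) (γ j) (γ k) = 0 := by
  let x (i : Fin d) (a : Fin 3) : MvPolynomial (Fin d × Fin 3) ℂ := .X (i, a)
  have := hγ (x i 0 * (x j 1 * x k 2 - x j 2 * x k 1) - x i 1 * (x j 0 * x k 2 - x j 2 * x k 0) +
    x i 2 * (x j 0 * x k 1 - x j 1 * x k 0)) (by
    rintro _ ⟨δ, hδ, rfl⟩
    simpa [x, det₃] using h δ hδ)
  simpa [x, det₃] using this

theorem mem_circuitVariety_pappus_iff {γ : Fin 9 → Fin 3 → ℂ} :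
    γ ∈ circuitVariety (makeLoops pappus {9}) ↔ γ 9 = 0 ∧ det₃ (γ 1) (γ 2) (γ 3) = 0 ∧
      det₃ (γ 1) (γ 6) (γ 8) = 0 ∧ det₃ (γ 1) (γ 5) (γ 7) = 0 ∧ det₃ (γ 2) (γ 4) (γ 7) = 0 ∧
      det₃ (γ 4) (γ 5) (γ 6) = 0 ∧ det₃ (γ 3) (γ 4) (γ 8) = 0 := by
  constructor
  · intro h
    have h9 : γ 9 = 0 := by
      have := h ({(9 : Fin 9)} : Finset (Fin 9)) ((Matroid.not_indep_iff (by
        simp [makeLoops, pappus, ofLines])).1 fun hi => by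
        have := ((makeLoops_pappus_indep_iff _ _).1 hi).2
        simp at this)
      by_contra h9
      exact this (by simpa using LinearIndepOn.singleton (R := ℂ) h9)
    have key (i j k : Fin 9) (hl : {i, j, k} ∈ pappusLines) (hij : i ≠ j) (hik : i ≠ k)
        (hjk : j ≠ k) : det₃ (γ i) (γ j) (γ k) = 0 := by
      have := h (({i, j, k} : Finset (Fin 9)) : Set (Fin 9)) ((Matroid.not_indep_iff (by
        simp [makeLoops, pappus, ofLines])).1 fun hi => by
        have := ((makeLoops_pappus_indep_iff _ _).1 hi).1.2 _ hl
        simp [Finset.card_eq_three.2 ⟨i, j, k, hij, hik, hjk, rfl⟩] at this)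
      by_contra h0
      exact this (by simpa using (linearIndepOn_triple γ hij hik hjk).2 h0)
    refine ⟨h9, ?_, ?_, ?_, ?_, ?_, ?_⟩ <;>
      exact key _ _ _ (by decide) (by decide) (by decide) (by decide)
  · rintro ⟨h9, h1, h2, h3, h4, h5, h6⟩
    refine includesDependencies_makeLoops_pappus (by simpa using h9) (forall_pappusLines.2 ?_)
    refine ⟨fun _ => ?_, fun _ => ?_, fun _ => ?_, fun _ => ?_, fun h => ?_, fun h => ?_,
      fun _ => ?_, fun _ => ?_, fun h => ?_⟩
    all_goals first
      | simp at h
      | (simp only [Finset.coe_insert, Finset.coe_singleton]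
         rw [linearIndepOn_triple _ (by decide) (by decide) (by decide), not_not]; assumption)

/-- Fewer independent sets mean more dependencies. The equations of the circuit variety are
polynomial, so they pass from realizations to their Zariski closure. -/
theorem matroidVariety_subset_circuitVariety {M : Matroid (Fin 9)}
    (hE : M.E = Set.univ) (hM : ∀ S : Finset (Fin 9), M.Indep S → (makeLoops pappus {9}).Indep S) :
    matroidVariety M ⊆ circuitVariety (makeLoops pappus {9}) := by
  have h : ∀ δ ∈ realizationSpace M, δ ∈ circuitVariety (makeLoops pappus {9}) := by
    intro δ hδ S hS
    refine (hδ S (by simp [hE])).1 ((Matroid.not_indep_iff (by simp [hE])).1 fun hi => ?_)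
    obtain ⟨S, rfl⟩ := S.toFinite.exists_finset_coe
    exact hS.not_indep (hM S hi)
  simp only [mem_circuitVariety_pappus_iff] at h
  intro γ hγ
  rw [mem_circuitVariety_pappus_iff]
  refine ⟨zero_of_mem_zariskiClosure (fun δ hδ => (h δ hδ).1) hγ, ?_, ?_, ?_, ?_, ?_, ?_⟩ <;>
    refine det₃_zero_of_mem_zariskiClosure (fun δ hδ => ?_) hγ <;> have := h δ hδ <;> tauto

/-- The point with parameter `t` of the line through `a` and `b`. -/
def lerp {E : Type*} [AddCommGroup E] [Module ℂ E] (t : ℂ) (a b : E) : E := a + t • (b - a)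

@[simp]
theorem lerp_zero {E : Type*} [AddCommGroup E] [Module ℂ E] (a b : E) : lerp 0 a b = a := by
  simp [lerp]

@[simp]
theorem lerp_one {E : Type*} [AddCommGroup E] [Module ℂ E] (a b : E) : lerp 1 a b = b := by
  simp [lerp]

theorem differentiable_lerp {E : Type*} [NormedAddCommGroup E] [NormedSpace ℂ E] (a b : E) :
    Differentiable ℂ fun t => lerp t a b := by
  unfold lerp; fun_prop

/-- A tuple in a family that contains a realization is in the matroid variety, if the family is
parametrized holomorphically and all its members include the dependencies. -/
theorem mem_matroidVariety_of_family {d : ℕ} {M : Matroid (Fin d)} {P : Type*}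
    [NormedAddCommGroup P] [NormedSpace ℂ P] {F : P → Fin d → Fin 3 → ℂ} (hF : Differentiable ℂ F)
    (h : ∀ v, IncludesDependencies M (F v)) {v₁ : P} (h1 : IsRealization M (F v₁)) (v : P) :
    F v ∈ matroidVariety M := by
  have := mem_matroidVariety_of_curve (γ := fun t => F (lerp t v v₁))
    (hF.comp (differentiable_lerp v v₁)) (fun t => h _) (s := 1) (by simpa using h1) 0
  simpa using this

/-- The realization conditions of a tuple of integer vectors. -/
theorem isRealization_intCast {J : Finset (Fin 9)} {γ : Fin 9 → Fin 3 → ℂ} {g : Fin 9 → Fin 3 → ℤ}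
    (hg : γ = fun i j => (g i j : ℂ)) (h : IncludesDependencies (makeLoops pappus J) γ)
    {B₀ : Finset (Fin 9)} (hB₀ : B₀.card = 3 ∧ B₀ ∉ pappusLines ∧ Disjoint B₀ J)
    (hI : ∀ i j k, i < j ∧ j < k ∧ i ∉ J ∧ j ∉ J ∧ k ∉ J ∧ {i, j, k} ∉ pappusLines →
      intDet₃ (g i) (g j) (g k) ≠ 0) : IsRealization (makeLoops pappus J) γ := by
  refine isRealization_makeLoops_pappus h (B₀ := B₀) ?_ hB₀.1 ?_
  · rw [makeLoops_pappus_indep_iff]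
    refine ⟨⟨hB₀.1.le, fun l hl _ hs => hB₀.2.1 ?_⟩, by simpa using hB₀.2.2⟩
    rwa [Finset.eq_of_subset_of_card_le hs (by rw [hB₀.1, card_pappusLines l hl])]
  · intro i j k hij hjk hi hj hk hl
    rw [hg, det₃_intCast]
    exact_mod_cast hI i j k
      ⟨hij, hjk, by simpa using hi, by simpa using hj, by simpa using hk, hl⟩


/-! ### The component of `M(9)` -/

/-- The realizations of `M(9)`, parametrized by the points `1`, `4`, `2`, slopes and scalings. -/
def pappusFamily (w : ((Fin 3 → ℂ) × (Fin 3 → ℂ) × (Fin 3 → ℂ)) × (Fin 9 → ℂ)) :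
    Fin 9 → Fin 3 → ℂ :=
  ![0, w.1.1, w.1.2.2, w.2 4 • (w.2 0 • w.1.1 + w.1.2.2), w.1.2.1,
    w.2 7 • (w.2 1 • w.1.1 + w.2 3 • w.1.2.1 + w.1.2.2),
    w.2 6 • (w.2 1 • w.1.1 + w.2 2 • w.1.2.1 + w.1.2.2), w.2 8 • (w.2 3 • w.1.2.1 + w.1.2.2),
    w.2 5 • (w.2 0 • w.1.1 + w.2 2 • w.1.2.1 + w.1.2.2)]

theorem differentiable_pappusFamily : Differentiable ℂ pappusFamily := by
  refine differentiable_pi.2 fun i => ?_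
  fin_cases i <;> simp [pappusFamily] <;> fun_prop

theorem pappusFamily_mem_circuitVariety
    (w : ((Fin 3 → ℂ) × (Fin 3 → ℂ) × (Fin 3 → ℂ)) × (Fin 9 → ℂ)) :
    pappusFamily w ∈ circuitVariety (makeLoops pappus {9}) := by
  rw [mem_circuitVariety_pappus_iff]
  refine ⟨rfl, ?_, ?_, ?_, ?_, ?_, ?_⟩ <;> simp [pappusFamily, det₃] <;> ring

/-- A realization of `M(9)`. -/
def pappusPoints : Fin 9 → Fin 3 → ℤ :=
  ![![0, 0, 0], ![1, 0, 0], ![0, 0, 1], ![-2, 0, 1], ![0, 1, 0], ![-1, 1, 1], ![-1, -2, 1],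
    ![0, 1, 1], ![-2, -2, 1]]

set_option maxRecDepth 10000 in
theorem pappusPoints_intDet₃_ne_zero : ∀ i j k : Fin 9, i < j ∧ j < k ∧ i ∉ ({9} : Finset (Fin 9)) ∧
    j ∉ ({9} : Finset (Fin 9)) ∧ k ∉ ({9} : Finset (Fin 9)) ∧ {i, j, k} ∉ pappusLines →
    intDet₃ (pappusPoints i) (pappusPoints j) (pappusPoints k) ≠ 0 := by
  decide

theorem pappusFamily_mem_matroidVariety
    (w : ((Fin 3 → ℂ) × (Fin 3 → ℂ) × (Fin 3 → ℂ)) × (Fin 9 → ℂ)) :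
    pappusFamily w ∈ matroidVariety (makeLoops pappus {9}) := by
  -- The parameters `v₁` (standard basis, unit scalings) produce `pappusPoints`, whose slopes avoid
  -- unwanted collinearities.
  refine mem_matroidVariety_of_family differentiable_pappusFamily pappusFamily_mem_circuitVariety
    (v₁ := ((![1, 0, 0], ![0, 1, 0], ![0, 0, 1]), ![-2, -1, -2, 1, 1, 1, 1, 1, 1])) ?_ w
  rw [← Finset.coe_singleton]
  refine isRealization_intCast (B₀ := {1, 2, 4}) (g := pappusPoints) ?_ ?_ (by decide)
    pappusPoints_intDet₃_ne_zero
  · ext i j; fin_cases i <;> fin_cases j <;> simp [pappusFamily, pappusPoints]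
  · rw [Finset.coe_singleton]
    exact pappusFamily_mem_circuitVariety _

/-- The tuple with `1 = p`, `4 = q` and a hexagon `x` on the other points. -/
def hexTuple (w : (Fin 3 → ℂ) × (Fin 3 → ℂ) × (Fin 6 → Fin 3 → ℂ)) : Fin 9 → Fin 3 → ℂ :=
  ![0, w.1, w.2.2 0, w.2.2 1, w.2.1, w.2.2 4, w.2.2 3, w.2.2 5, w.2.2 2]

theorem continuous_hexTuple : Continuous hexTuple := by
  refine continuous_pi fun i => ?_
  fin_cases i <;> simp [hexTuple] <;> fun_prop

/-- Scale every vertex to have coefficient one at `r = x 0`. A side through `p` then preserves the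
`q`-coefficient and a side through `q` the `p`-coefficient, so four slopes and five scalings
determine the hexagon. -/
theorem exists_hexTuple_eq_pappusFamily {p q : Fin 3 → ℂ} {x : Fin 6 → Fin 3 → ℂ}
    (h : HexDeps p q x) (hx : ∀ i, det₃ p q (x i) ≠ 0) :
    ∃ w, hexTuple (p, q, x) = pappusFamily w := by
  have hr := hx 0
  choose a b c habc using fun i => exists_eq_comb hr (x i)
  have hc : ∀ i, c i ≠ 0 := fun i h0 => hx i (by
    rw [habc i, h0]; simp [det₃]; ring)
  set r := x 0 with hr0
  obtain ⟨h0, h1, h2, h3, h4, h5⟩ := h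
  have e0 := det₃_comb_comb p q r 0 0 1 (a 1) (b 1) (c 1)
  have e5 := det₃_comb_comb' p q r (a 5) (b 5) (c 5) 0 0 1
  rw [← habc] at e0 e5
  have hb1 : b 1 = 0 := by simpa [show det₃ p r (x 1) = 0 from h0, hr] using e0
  have ha5 : a 5 = 0 := by simpa [show det₃ q (x 5) r = 0 from h5, hr] using e5
  rw [habc 1, habc 2, det₃_comb_comb'] at h1
  rw [habc 2, habc 3, det₃_comb_comb] at h2
  rw [habc 3, habc 4, det₃_comb_comb'] at h3
  rw [habc 4, habc 5, det₃_comb_comb] at h4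
  simp only [mul_eq_zero, hr, or_false] at h1 h2 h3 h4
  have h1' : c 2 * (a 1 / c 1) = a 2 := by
    have := hc 1; field_simp; linear_combination -h1
  have h2' : c 3 * (b 2 / c 2) = b 3 := by
    have := hc 2; field_simp; linear_combination h2
  have h3' : c 4 * (a 3 / c 3) = a 4 := by
    have := hc 3; field_simp; linear_combination -h3
  have h4' : c 5 * (b 4 / c 4) = b 5 := by
    have := hc 4; field_simp; linear_combination h4
  refine ⟨((p, q, r), ![a 1 / c 1, a 3 / c 3, b 2 / c 2, b 4 / c 4, c 1, c 2, c 3, c 4, c 5]), ?_⟩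
  ext i : 1
  fin_cases i
  · simp [hexTuple, pappusFamily]
  · simp [hexTuple, pappusFamily]
  · simp [hexTuple, pappusFamily, hr0]
  · simp [hexTuple, pappusFamily, habc 1, hb1, smul_smul, mul_div_cancel₀ _ (hc 1)]
  · simp [hexTuple, pappusFamily]
  · simp [hexTuple, pappusFamily, habc 4, h3', smul_smul, mul_div_cancel₀ _ (hc 4)]
  · simp [hexTuple, pappusFamily, habc 3, h2', smul_smul, mul_div_cancel₀ _ (hc 3)]
  · simp [hexTuple, pappusFamily, habc 5, ha5, h4', smul_smul]
  · simp [hexTuple, pappusFamily, habc 2, h1', smul_smul, mul_div_cancel₀ _ (hc 2)]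

theorem containsGeneric_matroidVariety :
    ContainsGeneric (hexTuple ⁻¹' matroidVariety (makeLoops pappus {9})) where
  isClosed := (isClosed_zariskiClosure _).preimage continuous_hexTuple
  mem p q x h hx := by
    obtain ⟨w, hw⟩ := exists_hexTuple_eq_pappusFamily h hx
    exact Set.mem_preimage.2 (hw ▸ pappusFamily_mem_matroidVariety w)

/-! ### The component of `U_{2,9}(9)` -/

theorem includesDependencies_uniform {γ : Fin 9 → Fin 3 → ℂ} (h0 : γ 0 = 0)
    (h : ∀ i j k, det₃ (γ i) (γ j) (γ k) = 0) :
    IncludesDependencies (makeLoops (uniform 2 9) {9}) γ := by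
  intro S hS
  obtain ⟨S, rfl⟩ := S.toFinite.exists_finset_coe
  have hS' := hS.not_indep
  rw [makeLoops_indep_iff, uniform_indep_iff, not_and_or] at hS'
  rcases hS' with hS' | hS'
  · obtain ⟨i, hi, j, hj, k, hk, hij, hik, hjk⟩ := Finset.two_lt_card.1 (not_le.1 hS')
    intro hl
    refine (linearIndepOn_triple γ hij hik hjk).1 (hl.mono ?_) (h i j k)
    simp [Set.insert_subset_iff, hi, hj, hk]
  · exact not_linearIndepOn_of_mem (i := 0) (by simpa using hS') h0

theorem mem_matroidVariety_uniform {γ : Fin 9 → Fin 3 → ℂ} (h0 : γ 0 = 0) {u v : Fin 3 → ℂ}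
    (h : ∀ i, ∃ a b : ℂ, γ i = a • u + b • v) :
    γ ∈ matroidVariety (makeLoops (uniform 2 9) {9}) := by
  choose a b hab using h
  let F : ((Fin 3 → ℂ) × (Fin 3 → ℂ)) × (Fin 9 → ℂ) × (Fin 9 → ℂ) → Fin 9 → Fin 3 → ℂ :=
    fun w i => if i = 0 then 0 else w.2.1 i • w.1.1 + w.2.2 i • w.1.2
  have hF : Differentiable ℂ F := by
    refine differentiable_pi.2 fun i => ?_
    by_cases hi : i = 0
    · simp [F, hi]
    · simp only [F, hi, if_false]; fun_prop
  have hdep : ∀ w, IncludesDependencies (makeLoops (uniform 2 9) {9}) (F w) := fun w => by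
    refine includesDependencies_uniform (by simp [F]) fun i j k => ?_
    simp only [F]
    split_ifs <;> (simp [det₃]; try ring)
  -- The vectors `(1, i, 0)` for `i ≠ 0` are pairwise nonproportional.
  have hreal : IsRealization (makeLoops (uniform 2 9) {9})
      (F ((![1, 0, 0], ![0, 1, 0]), 1, fun i => (i : ℕ))) := by
    refine isRealization_of_card (k := 2) (B₀ := {1, 2}) (hdep _) (fun S hS => ?_) ?_ rfl
      fun S hS hc => ?_
    · exact (uniform_indep_iff _ _ _).1 ((makeLoops_indep_iff _ _ _).1 hS).1
    · rw [makeLoops_indep_iff, uniform_indep_iff]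
      exact ⟨by decide, by simp⟩
    · have hd := ((makeLoops_indep_iff _ _ _).1 hS).2
      obtain ⟨i, j, hij, rfl⟩ := Finset.card_eq_two.1 hc
      have hi : i ≠ 0 := by rintro rfl; simp at hd
      have hj : j ≠ 0 := by rintro rfl; simp at hd
      rw [Finset.coe_insert, Finset.coe_singleton, LinearIndepOn.pair_iff _ hij]
      intro s t hst
      have h0 := congrFun hst 0
      have h1 := congrFun hst 1
      simp [F, hi, hj] at h0 h1
      have hij' : ((i : ℕ) : ℂ) - (j : ℕ) ≠ 0 := by
        rw [sub_ne_zero]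
        exact_mod_cast Fin.val_ne_of_ne hij
      have hs : s = 0 := (mul_eq_zero.1 (show s * (((i : ℕ) : ℂ) - (j : ℕ)) = 0 by
        linear_combination h1 - (j : ℕ) * h0)).resolve_right hij'
      exact ⟨hs, by simpa [hs] using h0⟩
  convert mem_matroidVariety_of_family hF hdep hreal ((u, v), a, b) using 1
  ext i : 1
  by_cases hi : i = 0
  · simp [F, hi, h0]
  · simp [F, hi, hab i]


/-! ### The components of `M(9,1)`, `M(9,4)` and `M(1,4,9)` -/

/-- The tuples realizing `M(9, 1)`: pairs of points on three lines through the point `4`. -/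
def familyThroughFour (w : (Fin 3 → ℂ) × (Fin 3 → Fin 3 → ℂ) × (Fin 9 → ℂ) × (Fin 9 → ℂ)) :
    Fin 9 → Fin 3 → ℂ :=
  ![0, 0, w.2.2.1 2 • w.1 + w.2.2.2 2 • w.2.1 0, w.2.2.1 3 • w.1 + w.2.2.2 3 • w.2.1 2, w.1,
    w.2.2.1 5 • w.1 + w.2.2.2 5 • w.2.1 1, w.2.2.1 6 • w.1 + w.2.2.2 6 • w.2.1 1,
    w.2.2.1 7 • w.1 + w.2.2.2 7 • w.2.1 0, w.2.2.1 8 • w.1 + w.2.2.2 8 • w.2.1 2]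

/-- The tuples realizing `M(9, 4)`: pairs of points on three lines through the point `1`. -/
def familyThroughOne (w : (Fin 3 → ℂ) × (Fin 3 → Fin 3 → ℂ) × (Fin 9 → ℂ) × (Fin 9 → ℂ)) :
    Fin 9 → Fin 3 → ℂ :=
  ![0, w.1, w.2.2.1 2 • w.1 + w.2.2.2 2 • w.2.1 0, w.2.2.1 3 • w.1 + w.2.2.2 3 • w.2.1 0, 0,
    w.2.2.1 5 • w.1 + w.2.2.2 5 • w.2.1 2, w.2.2.1 6 • w.1 + w.2.2.2 6 • w.2.1 1,
    w.2.2.1 7 • w.1 + w.2.2.2 7 • w.2.1 2, w.2.2.1 8 • w.1 + w.2.2.2 8 • w.2.1 1]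

theorem differentiable_familyThroughFour : Differentiable ℂ familyThroughFour := by
  refine differentiable_pi.2 fun i => ?_
  fin_cases i <;> simp [familyThroughFour] <;> fun_prop

theorem differentiable_familyThroughOne : Differentiable ℂ familyThroughOne := by
  refine differentiable_pi.2 fun i => ?_
  fin_cases i <;> simp [familyThroughOne] <;> fun_prop

theorem not_linearIndepOn_triple {γ : Fin 9 → Fin 3 → ℂ} {i j k : Fin 9} (hij : i ≠ j)
    (hik : i ≠ k) (hjk : j ≠ k) (h : det₃ (γ i) (γ j) (γ k) = 0) :
    ¬ LinearIndepOn ℂ γ (({i, j, k} : Finset (Fin 9)) : Set (Fin 9)) := by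
  simp only [Finset.coe_insert, Finset.coe_singleton]
  rwa [linearIndepOn_triple _ hij hik hjk, not_not]

theorem includesDependencies_familyThroughFour
    (w : (Fin 3 → ℂ) × (Fin 3 → Fin 3 → ℂ) × (Fin 9 → ℂ) × (Fin 9 → ℂ)) :
    IncludesDependencies (makeLoops pappus {9, 1}) (familyThroughFour w) := by
  refine includesDependencies_makeLoops_pappus (by simp [familyThroughFour])
    (forall_pappusLines.2 ⟨?_, ?_, ?_, ?_, ?_, ?_, ?_, ?_, ?_⟩) <;> intro h
  all_goals first
    | (exfalso; revert h; simp; done)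
    | (refine not_linearIndepOn_triple (by decide) (by decide) (by decide) ?_
       simp [familyThroughFour, det₃]; ring)

theorem includesDependencies_familyThroughOne
    (w : (Fin 3 → ℂ) × (Fin 3 → Fin 3 → ℂ) × (Fin 9 → ℂ) × (Fin 9 → ℂ)) :
    IncludesDependencies (makeLoops pappus {9, 4}) (familyThroughOne w) := by
  refine includesDependencies_makeLoops_pappus (by simp [familyThroughOne])
    (forall_pappusLines.2 ⟨?_, ?_, ?_, ?_, ?_, ?_, ?_, ?_, ?_⟩) <;> intro h
  all_goals first
    | (exfalso; revert h; simp; done)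
    | (refine not_linearIndepOn_triple (by decide) (by decide) (by decide) ?_
       simp [familyThroughOne, det₃]; ring)

/-- Every Pappus line meets `{1, 4, 9}`, so only the loops impose conditions. -/
theorem includesDependencies_of_zero {γ : Fin 9 → Fin 3 → ℂ} (h : γ 1 = 0 ∧ γ 4 = 0 ∧ γ 0 = 0) :
    IncludesDependencies (makeLoops pappus {1, 4, 9}) γ := by
  refine includesDependencies_makeLoops_pappus (by simpa using h)
    (forall_pappusLines.2 ⟨?_, ?_, ?_, ?_, ?_, ?_, ?_, ?_, ?_⟩) <;>
  · intro h
    exfalso; revert h; simp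

/-- A realization of `M(9, 1)`. -/
def pointsThroughFour : Fin 9 → Fin 3 → ℤ :=
  ![![0, 0, 0], ![0, 0, 0], ![0, -1, 1], ![-1, -1, 1], ![0, 1, 0], ![1, 1, 1], ![1, 0, 1],
    ![0, 1, 1], ![-1, 0, 1]]

/-- A realization of `M(9, 4)`. -/
def pointsThroughOne : Fin 9 → Fin 3 → ℤ :=
  ![![0, 0, 0], ![0, 1, 0], ![0, -1, 1], ![0, 1, 1], ![0, 0, 0], ![-1, 0, 1], ![1, 1, 1],
    ![-1, -1, 1], ![1, 0, 1]]

/-- A realization of `M(1, 4, 9)`. -/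
def pointsOnConic : Fin 9 → Fin 3 → ℤ :=
  ![![0, 0, 0], ![0, 0, 0], ![1, 2, 4], ![1, 3, 9], ![0, 0, 0], ![1, 5, 25], ![1, 6, 36],
    ![1, 7, 49], ![1, 8, 64]]

set_option maxRecDepth 10000 in
theorem pointsThroughFour_intDet₃_ne_zero : ∀ i j k : Fin 9, i < j ∧ j < k ∧
    i ∉ ({9, 1} : Finset (Fin 9)) ∧ j ∉ ({9, 1} : Finset (Fin 9)) ∧
    k ∉ ({9, 1} : Finset (Fin 9)) ∧ {i, j, k} ∉ pappusLines →
    intDet₃ (pointsThroughFour i) (pointsThroughFour j) (pointsThroughFour k) ≠ 0 := by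
  decide

set_option maxRecDepth 10000 in
theorem pointsThroughOne_intDet₃_ne_zero : ∀ i j k : Fin 9, i < j ∧ j < k ∧
    i ∉ ({9, 4} : Finset (Fin 9)) ∧ j ∉ ({9, 4} : Finset (Fin 9)) ∧
    k ∉ ({9, 4} : Finset (Fin 9)) ∧ {i, j, k} ∉ pappusLines →
    intDet₃ (pointsThroughOne i) (pointsThroughOne j) (pointsThroughOne k) ≠ 0 := by
  decide

set_option maxRecDepth 10000 in
theorem pointsOnConic_intDet₃_ne_zero : ∀ i j k : Fin 9, i < j ∧ j < k ∧
    i ∉ ({1, 4, 9} : Finset (Fin 9)) ∧ j ∉ ({1, 4, 9} : Finset (Fin 9)) ∧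
    k ∉ ({1, 4, 9} : Finset (Fin 9)) ∧ {i, j, k} ∉ pappusLines →
    intDet₃ (pointsOnConic i) (pointsOnConic j) (pointsOnConic k) ≠ 0 := by
  decide

theorem familyThroughFour_mem_matroidVariety
    (w : (Fin 3 → ℂ) × (Fin 3 → Fin 3 → ℂ) × (Fin 9 → ℂ) × (Fin 9 → ℂ)) :
    familyThroughFour w ∈ matroidVariety (makeLoops pappus {9, 1}) := by
  refine mem_matroidVariety_of_family differentiable_familyThroughFour
    includesDependencies_familyThroughFour
    (v₁ := (![0, 1, 0], ![![0, 0, 1], ![1, 0, 1], ![-1, 0, 1]],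
      ![0, 0, -1, -1, 0, 1, 0, 1, 0], 1)) ?_ w
  have := includesDependencies_familyThroughFour
    (![0, 1, 0], ![![0, 0, 1], ![1, 0, 1], ![-1, 0, 1]],
      ![0, 0, -1, -1, 0, 1, 0, 1, 0], 1)
  rw [← Finset.coe_singleton, ← Finset.coe_insert] at this ⊢
  refine isRealization_intCast (B₀ := {2, 3, 4}) (g := pointsThroughFour) ?_ this (by decide)
    pointsThroughFour_intDet₃_ne_zero
  ext i j; fin_cases i <;> fin_cases j <;> simp [familyThroughFour, pointsThroughFour]

theorem familyThroughOne_mem_matroidVariety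
    (w : (Fin 3 → ℂ) × (Fin 3 → Fin 3 → ℂ) × (Fin 9 → ℂ) × (Fin 9 → ℂ)) :
    familyThroughOne w ∈ matroidVariety (makeLoops pappus {9, 4}) := by
  refine mem_matroidVariety_of_family differentiable_familyThroughOne
    includesDependencies_familyThroughOne
    (v₁ := (![0, 1, 0], ![![0, 0, 1], ![1, 0, 1], ![-1, 0, 1]],
      ![0, 0, -1, 1, 0, 0, 1, -1, 0], 1)) ?_ w
  have := includesDependencies_familyThroughOne
    (![0, 1, 0], ![![0, 0, 1], ![1, 0, 1], ![-1, 0, 1]],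
      ![0, 0, -1, 1, 0, 0, 1, -1, 0], 1)
  rw [← Finset.coe_singleton, ← Finset.coe_insert] at this ⊢
  refine isRealization_intCast (B₀ := {1, 2, 5}) (g := pointsThroughOne) ?_ this (by decide)
    pointsThroughOne_intDet₃_ne_zero
  ext i j; fin_cases i <;> fin_cases j <;> simp [familyThroughOne, pointsThroughOne]

theorem mem_matroidVariety_of_zero {γ : Fin 9 → Fin 3 → ℂ} (h : γ 1 = 0 ∧ γ 4 = 0 ∧ γ 0 = 0) :
    γ ∈ matroidVariety (makeLoops pappus {1, 4, 9}) := by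
  -- The points `(1, i, i²)` have nonzero Vandermonde determinants; the segment from `γ` to `δ`
  -- keeps the loops zero.
  let δ : Fin 9 → Fin 3 → ℂ := fun i j => pointsOnConic i j
  have h1 : δ 1 = 0 ∧ δ 4 = 0 ∧ δ 0 = 0 := by
    refine ⟨?_, ?_, ?_⟩ <;> ext j <;> fin_cases j <;> simp [δ, pointsOnConic]
  have := mem_matroidVariety_of_curve (M := makeLoops pappus {1, 4, 9}) (differentiable_lerp γ δ)
    (fun t => includesDependencies_of_zero (by simp [lerp, h, h1])) (s := 1) ?_ 0
  · simpa using this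
  · rw [lerp_one]
    have := includesDependencies_of_zero h1
    rw [← Finset.coe_singleton, ← Finset.coe_insert, ← Finset.coe_insert] at this ⊢
    exact isRealization_intCast (B₀ := {2, 3, 5}) rfl this (by decide)
      pointsOnConic_intDet₃_ne_zero

/-- A vector dependent with two independent vectors is a combination of them. -/
theorem exists_comb_of_linearIndependent {p x y : Fin 3 → ℂ} (hx : LinearIndependent ℂ ![p, x])
    (h : det₃ p x y = 0) : ∃ a b : ℂ, y = a • p + b • x := by
  have : y ∈ Submodule.span ℂ (Set.range ![p, x]) := by
    by_contra hy
    have := linearIndependent_finSnoc.2 ⟨hx, hy⟩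
    have e : (Fin.snoc ![p, x] y : Fin 3 → Fin 3 → ℂ) = ![p, x, y] := by
      ext i : 1
      fin_cases i <;> rfl
    rw [e, linearIndependent_iff_det₃_ne_zero] at this
    exact this h
  rw [Matrix.range_cons, Matrix.range_cons, Matrix.range_empty, Set.union_empty,
    Set.singleton_union, Submodule.mem_span_pair] at this
  obtain ⟨a, b, rfl⟩ := this
  exact ⟨a, b, rfl⟩

/-- Two vectors that are dependent with `p ≠ 0` lie in a plane containing `p`. -/
theorem exists_comb_of_det₃_eq_zero {p x y : Fin 3 → ℂ} (hp : p ≠ 0) (h : det₃ p x y = 0) :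
    ∃ (w : Fin 3 → ℂ) (a b c d : ℂ), x = a • p + b • w ∧ y = c • p + d • w := by
  by_cases hx : LinearIndependent ℂ ![p, x]
  · obtain ⟨c, d, hy⟩ := exists_comb_of_linearIndependent hx h
    exact ⟨x, 0, 1, c, d, by simp, hy⟩
  · rw [LinearIndependent.pair_iff' hp] at hx
    push Not at hx
    obtain ⟨a, rfl⟩ := hx
    exact ⟨y, a, 0, 0, 1, by simp, by simp⟩


/-! ### Case analysis and the converse inclusion -/

theorem hexDeps_of_mem_circuitVariety {γ : Fin 9 → Fin 3 → ℂ}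
    (h : γ ∈ circuitVariety (makeLoops pappus {9})) :
    HexDeps (γ 1) (γ 4) ![γ 2, γ 3, γ 8, γ 6, γ 5, γ 7] := by
  obtain ⟨-, h1, h2, h3, h4, h5, h6⟩ := mem_circuitVariety_pappus_iff.1 h
  refine ⟨h1, ?_, ?_, ?_, h3, ?_⟩
  · exact (det₃_swap _ _ _).trans (neg_eq_zero.2 h6)
  · exact (det₃_swap_right _ _ _).trans (neg_eq_zero.2 h2)
  · exact (det₃_swap_right _ _ _).trans (neg_eq_zero.2 h5)
  · exact (det₃_swap_right _ _ _).trans (neg_eq_zero.2 ((det₃_swap _ _ _).trans (neg_eq_zero.2 h4)))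

theorem hexTuple_eq {γ : Fin 9 → Fin 3 → ℂ} (h : γ 0 = 0) :
    hexTuple (γ 1, γ 4, ![γ 2, γ 3, γ 8, γ 6, γ 5, γ 7]) = γ := by
  ext i : 1
  fin_cases i <;> simp [hexTuple, h]

theorem forall_of_forall_hexagon {γ : Fin 9 → Fin 3 → ℂ} {P : (Fin 3 → ℂ) → Prop} (h0 : P (γ 0))
    (h1 : P (γ 1)) (h4 : P (γ 4)) (h : ∀ i, P (![γ 2, γ 3, γ 8, γ 6, γ 5, γ 7] i)) (i : Fin 9) :
    P (γ i) := by
  fin_cases i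
  exacts [h0, h1, h 0, h 1, h4, h 4, h 3, h 5, h 2]

/-- Either some determinant involving `γ 1` is nonzero and a hexagon lemma applies, or all vectors
lie in a common plane. This is examined separately for `γ 1, γ 4` independent and parallel. -/
theorem mem_union_of_ne_zero {γ : Fin 9 → Fin 3 → ℂ}
    (h : γ ∈ circuitVariety (makeLoops pappus {9})) (h1 : γ 1 ≠ 0) (h4 : γ 4 ≠ 0) :
    γ ∈ matroidVariety (makeLoops pappus {9}) ∨
      γ ∈ matroidVariety (makeLoops (uniform 2 9) {9}) := by
  have h0 : γ 0 = 0 := (mem_circuitVariety_pappus_iff.1 h).1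
  have hd := hexDeps_of_mem_circuitVariety h
  have hV := containsGeneric_matroidVariety
  rw [← hexTuple_eq h0]
  by_cases hpq : LinearIndependent ℂ ![γ 1, γ 4]
  · by_cases hr : ∃ i, det₃ (γ 1) (γ 4) (![γ 2, γ 3, γ 8, γ 6, γ 5, γ 7] i) ≠ 0
    · obtain ⟨i, hi⟩ := hr
      exact Or.inl (ContainsGeneric.mem_of_det₃_ne_zero i hV hd hi)
    · push Not at hr
      right
      rw [hexTuple_eq h0]
      refine mem_matroidVariety_uniform h0 (u := γ 1) (v := γ 4)
        (forall_of_forall_hexagon (P := fun y => ∃ a b : ℂ, y = a • γ 1 + b • γ 4)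
          ⟨0, 0, by simp [h0]⟩ ⟨1, 0, by simp⟩ ⟨0, 1, by simp⟩ fun i =>
          exists_comb_of_linearIndependent hpq (hr i))
  · rw [LinearIndependent.pair_iff' h1] at hpq
    push Not at hpq
    obtain ⟨k, hk⟩ := hpq
    have hk0 : k ≠ 0 := by
      rintro rfl
      exact h4 (by simpa using hk.symm)
    by_cases hr : ∃ i j, det₃ (γ 1) (![γ 2, γ 3, γ 8, γ 6, γ 5, γ 7] i)
        (![γ 2, γ 3, γ 8, γ 6, γ 5, γ 7] j) ≠ 0
    · obtain ⟨i, j, hij⟩ := hr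
      left
      rw [← hk] at hd ⊢
      exact hV.mem_of_parallel hk0 hd hij
    · push Not at hr
      right
      rw [hexTuple_eq h0]
      by_cases hs : ∃ i, LinearIndependent ℂ ![γ 1, ![γ 2, γ 3, γ 8, γ 6, γ 5, γ 7] i]
      · obtain ⟨i, hi⟩ := hs
        exact mem_matroidVariety_uniform h0 (forall_of_forall_hexagon
          (P := fun y => ∃ a b : ℂ, y = a • γ 1 + b • ![γ 2, γ 3, γ 8, γ 6, γ 5, γ 7] i)
          ⟨0, 0, by simp [h0]⟩ ⟨1, 0, by simp⟩ ⟨k, 0, by simp [← hk]⟩ fun j =>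
          exists_comb_of_linearIndependent hi (hr i j))
      · simp only [LinearIndependent.pair_iff' h1] at hs
        push Not at hs
        exact mem_matroidVariety_uniform h0 (u := γ 1) (v := 0) (forall_of_forall_hexagon
          (P := fun y => ∃ a b : ℂ, y = a • γ 1 + b • (0 : Fin 3 → ℂ))
          ⟨0, 0, by simp [h0]⟩ ⟨1, 0, by simp⟩ ⟨k, 0, by simp [← hk]⟩ fun j =>
          (hs j).imp fun a ha => ⟨0, by simp [← ha]⟩)

/-- Only the lines through `4` survive. They carry the disjoint pairs `{2, 7}`, `{5, 6}`, `{3, 8}`,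
each of which can be parametrized independently. -/
theorem mem_of_one_eq_zero {γ : Fin 9 → Fin 3 → ℂ}
    (h : γ ∈ circuitVariety (makeLoops pappus {9})) (h1 : γ 1 = 0) (h4 : γ 4 ≠ 0) :
    γ ∈ matroidVariety (makeLoops pappus {9, 1}) := by
  have h0 : γ 0 = 0 := (mem_circuitVariety_pappus_iff.1 h).1
  obtain ⟨-, e1, -, e3, -, e5⟩ := hexDeps_of_mem_circuitVariety h
  obtain ⟨w0, a7, b7, a2, b2, h7, h2⟩ := exists_comb_of_det₃_eq_zero h4
    (show det₃ (γ 4) (γ 7) (γ 2) = 0 from e5)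
  obtain ⟨w1, a6, b6, a5, b5, h6, h5⟩ := exists_comb_of_det₃_eq_zero h4
    (show det₃ (γ 4) (γ 6) (γ 5) = 0 from e3)
  obtain ⟨w2, a3, b3, a8, b8, h3, h8⟩ := exists_comb_of_det₃_eq_zero h4
    (show det₃ (γ 4) (γ 3) (γ 8) = 0 from e1)
  convert familyThroughFour_mem_matroidVariety (γ 4, ![w0, w1, w2],
    ![0, 0, a2, a3, 0, a5, a6, a7, a8], ![0, 0, b2, b3, 0, b5, b6, b7, b8]) using 1
  ext i : 1
  fin_cases i <;> simp [familyThroughFour, h0, h1] <;> assumption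

theorem mem_of_four_eq_zero {γ : Fin 9 → Fin 3 → ℂ}
    (h : γ ∈ circuitVariety (makeLoops pappus {9})) (h1 : γ 1 ≠ 0) (h4 : γ 4 = 0) :
    γ ∈ matroidVariety (makeLoops pappus {9, 4}) := by
  have h0 : γ 0 = 0 := (mem_circuitVariety_pappus_iff.1 h).1
  obtain ⟨e0, -, e2, -, e4, -⟩ := hexDeps_of_mem_circuitVariety h
  obtain ⟨w0, a2, b2, a3, b3, h2, h3⟩ := exists_comb_of_det₃_eq_zero h1
    (show det₃ (γ 1) (γ 2) (γ 3) = 0 from e0)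
  obtain ⟨w1, a8, b8, a6, b6, h8, h6⟩ := exists_comb_of_det₃_eq_zero h1
    (show det₃ (γ 1) (γ 8) (γ 6) = 0 from e2)
  obtain ⟨w2, a5, b5, a7, b7, h5, h7⟩ := exists_comb_of_det₃_eq_zero h1
    (show det₃ (γ 1) (γ 5) (γ 7) = 0 from e4)
  convert familyThroughOne_mem_matroidVariety (γ 1, ![w0, w1, w2],
    ![0, 0, a2, a3, 0, a5, a6, a7, a8], ![0, 0, b2, b3, 0, b5, b6, b7, b8]) using 1
  ext i : 1
  fin_cases i <;> simp [familyThroughOne, h0, h4] <;> assumption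

theorem matroidVariety_makeLoops_pappus_subset {J : Set (Fin 9)} (hJ : 9 ∈ J) :
    matroidVariety (makeLoops pappus J) ⊆ circuitVariety (makeLoops pappus {9}) := by
  refine matroidVariety_subset_circuitVariety (by simp [makeLoops, pappus, ofLines])
    fun S hS => ?_
  rw [makeLoops_indep_iff] at hS ⊢
  exact ⟨hS.1, hS.2.mono_right (by simpa using hJ)⟩

theorem matroidVariety_uniform_subset :
    matroidVariety (makeLoops (uniform 2 9) {9}) ⊆ circuitVariety (makeLoops pappus {9}) := by
  refine matroidVariety_subset_circuitVariety (by simp [makeLoops, uniform]) fun S hS => ?_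
  rw [makeLoops_indep_iff, uniform_indep_iff] at hS
  rw [makeLoops_pappus_indep_iff]
  exact ⟨⟨by omega, fun _ _ h3 => by omega⟩, hS.2⟩

end MatroidVar

theorem mainTheorem10 :
    MatroidVar.circuitVariety (MatroidVar.makeLoops MatroidVar.pappus {9}) =
      MatroidVar.matroidVariety (MatroidVar.makeLoops MatroidVar.pappus {9}) ∪
        MatroidVar.matroidVariety (MatroidVar.makeLoops (MatroidVar.uniform 2 9) {9}) ∪
        MatroidVar.matroidVariety (MatroidVar.makeLoops MatroidVar.pappus {9, 1}) ∪
        MatroidVar.matroidVariety (MatroidVar.makeLoops MatroidVar.pappus {9, 4}) ∪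
        MatroidVar.matroidVariety (MatroidVar.makeLoops MatroidVar.pappus {1, 4, 9}) := by
  refine Set.Subset.antisymm (fun γ h => ?_) ?_
  · simp only [Set.mem_union]
    by_cases h1 : γ 1 = 0
    · by_cases h4 : γ 4 = 0
      · exact Or.inr (MatroidVar.mem_matroidVariety_of_zero
          ⟨h1, h4, (MatroidVar.mem_circuitVariety_pappus_iff.1 h).1⟩)
      · exact Or.inl (Or.inl (Or.inr (MatroidVar.mem_of_one_eq_zero h h1 h4)))
    · by_cases h4 : γ 4 = 0
      · exact Or.inl (Or.inr (MatroidVar.mem_of_four_eq_zero h h1 h4))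
      · exact Or.inl (Or.inl (Or.inl (MatroidVar.mem_union_of_ne_zero h h1 h4)))
  · simp only [Set.union_subset_iff]
    exact ⟨⟨⟨⟨MatroidVar.matroidVariety_makeLoops_pappus_subset (by simp),
      MatroidVar.matroidVariety_uniform_subset⟩,
      MatroidVar.matroidVariety_makeLoops_pappus_subset (by simp)⟩,
      MatroidVar.matroidVariety_makeLoops_pappus_subset (by simp)⟩,
      MatroidVar.matroidVariety_makeLoops_pappus_subset (by simp)⟩
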